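/- Let $\mathbb K=\mathbb R,\mathbb C$ or $\mathbb H$ and correspondingly $\beta=1,2$ or $4$, let $N\ge 1$, and let $M$ be the space of $N\times N$ positive definite Hermitian matrices with entries in $\mathbb K$ (real, complex or quaternion covariance matrices), an open subset of the real vector space $\mathcal H$ of $N\times N$ Hermitian matrices over $\mathbb K$, of dimension $d=N+\beta N(N-1)/2$. Equip $M$ with the affine-invariant Riemannian metric $\langle u,v\rangle_x=\mathrm{Re}\,\mathrm{tr}(x^{-1}ux^{-1}v)$, $u,v\in\mathcal H$, and let $x_o=\mathrm{id}$, so that $T_{x_o}M=\mathcal H$ with scalar product $\mathrm{Re}\,\mathrm{tr}(uv)$. Every $s\in\mathcal H$ can be written $s=k\,\mathrm{diag}(\varsigma_1,\dots,\varsigma_N)\,k^{\dagger}$ with $k$ unitary over $\mathbb K$ and $\varsigma_i$ real (the eigenvalues of $s$); put $\kappa_{ij}(s)=(\varsigma_i-\varsigma_j)/2$ for $i<j$. For a unit vector $s\in T_{x_o}M$ let $A(r,s)$ be the $(d-1)\times(d-1)$ matrix solution of the matrix Jacobi equation $A''+R(r,s)A=0$, $A(0,s)=0$, $A'(0,s)=\mathrm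 I$, where $R(r,s)$ is the matrix of the radial curvature operator $u\mapsto R(u,\dot\gamma)\dot\gamma$ along the geodesic $\gamma$ with $\gamma(0)=x_o$, $\dot\gamma(0)=s$, with respect to a parallel frame along $\gamma$ that is at $x_o$ an orthonormal basis of $s^\perp$. Here $R$ is the Riemann curvature tensor, with the sign convention in which the sectional curvature is $\mathrm{sec}(u,v)=\langle R(u,v)v,u\rangle/(\|u\|^2\|v\|^2-\langle u,v\rangle^2)$. Then: 1. (Volume density.) Such an $A$ exists, and for all $r\ge 0$ $$\det A(r,s)=r^{N-1}\prod_{i<j}\left(\frac{\sinh(\kappa_{ij}(s)\,r)}{\kappa_{ij}(s)}\right)^{\beta},$$ where the quotient is read as $r$ if $\kappa_{ij}(s)=0$. For $\mathbb K=\mathbb R$ the exponent is $\beta=1$. Moreover $|\det A|$ is the Riemannian volume density in geodesic polar coordinates: for every measurable $f:M\to[0,\infty]$, $$\int_M f\,d\mathrm{vol}=\int_{S_{x_o}M}\int_0^\infty f(\mathrm{Exp}_{x_o}(rs))\,|\det A(r,s)|\,dr\,\omega(ds),$$ where $\omega$ is the surface measure on the unit sphere $S_{x_o}M$ of $T_{x_o}M$.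 2. (Principal curvatures.) For every unit vector $s\in T_{x_o}M$ there is an orthonormal basis $(u_\alpha)_{\alpha=1,\dots,d}$ of $T_{x_o}M$, with $u_1=s$, of eigenvectors of the radial curvature operator $R_s(u)=R(u,s)s$, with eigenvalues $\lambda_\alpha$ as follows: $0$ with multiplicity $N$ (including $\lambda_1=0$), and $-\kappa_{ij}(s)^2$, $\beta$ times for each $i<j$. For $\alpha\ne1$ the sectional curvature is $\mathrm{sec}(s,u_\alpha)=\lambda_\alpha$. 3. (Curvature bound.) All sectional curvatures of $M$, at every point, lie in $[-\tfrac12,0]$. If $N\ge2$, the least sectional curvature (at every point of $M$) is $-\kappa^2$ with $\kappa=1/\sqrt2$, and $-\kappa^2=\min\,(-\kappa_{ij}(s)^2)$ over unit vectors $s\in T_{x_o}M$ and $i<j$. -/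

import Mathlib

open MeasureTheory Matrix
open scoped ENNReal

noncomputable section

/-! ## Riemannian geometry on an open subset `U` of a real vector space `E`

The tangent space at each point is identified with `E`, and a Riemannian metric is a function
`g : E → E → E → ℝ`, where `g x u v` is the inner product of `u` and `v` at `x ∈ U`. -/

namespace Riem

variable {E : Type*} [NormedAddCommGroup E] [NormedSpace ℝ E]

/-- `½ (∂_u g(v,w) + ∂_v g(u,w) - ∂_w g(u,v))` at `x`, for constant fields `u, v, w`. -/
def koszul (g : E → E → E → ℝ) (x u v w : E) : ℝ :=
  (fderiv ℝ (fun y => g y v w) x u + fderiv ℝ (fun y => g y u w) x v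
    - fderiv ℝ (fun y => g y u v) x w) / 2

/-- The Christoffel map `Γ_x(u,v)` of the Levi-Civita connection `∇_u V = ∂_u V + Γ(u,V)`: the
vector `z` with `g_x(z,w) = ½ (∂_u g(v,w) + ∂_v g(u,w) - ∂_w g(u,v))` for all `w` (it exists and
is unique when `g_x` is positive definite and `E` is finite-dimensional). -/
def christoffel (g : E → E → E → ℝ) (x u v : E) : E :=
  Classical.epsilon fun z => ∀ w, g x z w = koszul g x u v w

/-- The Riemann curvature tensor `R(u,v)w = ∇_u ∇_v w - ∇_v ∇_u w` (constant fields, so that the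
bracket term vanishes). -/
def curvature (g : E → E → E → ℝ) (x u v w : E) : E :=
  fderiv ℝ (fun y => christoffel g y v w) x u - fderiv ℝ (fun y => christoffel g y u w) x v
    + christoffel g x u (christoffel g x v w) - christoffel g x v (christoffel g x u w)

/-- The radial curvature operator (Jacobi operator) `R_s(u) = R(u,s)s`. With the opposite sign
convention for `R` this reads `R(s,u)s`. -/
def radialCurvature (g : E → E → E → ℝ) (x s u : E) : E := curvature g x u s s

/-- The sectional curvature of the plane spanned by `u` and `v` (linearly independent). -/
def sectional (g : E → E → E → ℝ) (x u v : E) : ℝ :=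
  g x (curvature g x u v v) u / (g x u u * g x v v - g x u v ^ 2)

/-- Complete geodesics in `U`. -/
structure IsGeodesic (g : E → E → E → ℝ) (U : Set E) (γ : ℝ → E) : Prop where
  mem : ∀ t, γ t ∈ U
  contDiff : ContDiff ℝ 2 γ
  eq_zero : ∀ t, deriv (deriv γ) t + christoffel g (γ t) (deriv γ t) (deriv γ t) = 0

/-- Parallel vector fields along a curve `γ`. -/
structure IsParallel (g : E → E → E → ℝ) (γ : ℝ → E) (V : ℝ → E) : Prop where
  differentiable : Differentiable ℝ V
  eq_zero : ∀ t, deriv V t + christoffel g (γ t) (deriv γ t) (V t) = 0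

/-- The Riemannian exponential map `Exp_{xo}(v) = γ(1)`, where `γ` is the geodesic with `γ(0) = xo`
and `γ'(0) = v`. -/
def riemExp (g : E → E → E → ℝ) (U : Set E) (xo v : E) : E :=
  Classical.epsilon fun y => ∃ γ : ℝ → E, IsGeodesic g U γ ∧ γ 0 = xo ∧ deriv γ 0 = v ∧ γ 1 = y

/-- `A` solves the matrix Jacobi equation along the geodesic issued from `xo` with unit initial
velocity `s`: for the geodesic `γ` and some parallel frame `e` along `γ` whose value at `0` is an
orthonormal basis of the orthogonal complement of `s`, one has
`A'' + R A = 0`, `A(0) = 0`, `A'(0) = I`, where `R(r)` is the matrix of the radial curvature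
operator `R_{γ'(r)}` in the frame `e(r)`. -/
def IsJacobiMatrix (g : E → E → E → ℝ) (U : Set E) (xo s : E)
    (A : ℝ → Matrix (Fin (Module.finrank ℝ E - 1)) (Fin (Module.finrank ℝ E - 1)) ℝ) : Prop :=
  ∃ (γ : ℝ → E) (e : Fin (Module.finrank ℝ E - 1) → ℝ → E),
    IsGeodesic g U γ ∧ γ 0 = xo ∧ deriv γ 0 = s ∧
    (∀ i, IsParallel g γ (e i)) ∧
    (∀ i j, g xo (e i 0) (e j 0) = if i = j then 1 else 0) ∧
    (∀ i, g xo (e i 0) s = 0) ∧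
    (∀ i j, ContDiff ℝ 2 fun r => A r i j) ∧
    A 0 = 0 ∧
    (∀ i j, deriv (fun r => A r i j) 0 = (1 : Matrix _ _ ℝ) i j) ∧
    ∀ r i j, deriv (deriv fun t => A t i j) r +
      ((Matrix.of fun k l => g (γ r) (radialCurvature g (γ r) (deriv γ r) (e l r)) (e k r)) * A r)
        i j = 0

/-- The Riemannian volume measure of `(U, g)`: it has density `√(det g)` with respect to Lebesgue
measure in orthonormal coordinates of the Euclidean space `E`. -/
def riemVolume {E : Type*} [NormedAddCommGroup E] [InnerProductSpace ℝ E] [FiniteDimensional ℝ E]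
    [MeasurableSpace E] [BorelSpace E] (g : E → E → E → ℝ) (U : Set E) : Measure E :=
  (volume.restrict U).withDensity fun x =>
    ENNReal.ofReal √(Matrix.det (Matrix.of fun i j =>
      g x (stdOrthonormalBasis ℝ E i) (stdOrthonormalBasis ℝ E j)))

end Riem

/-! ## Real, complex and quaternion covariance matrices -/

/-- The three kinds of matrix entries. -/
inductive Scalars where
  | real
  | complex
  | quaternion

namespace Scalars

/-- `ℝ`, `ℂ` or `ℍ`. -/
def K : Scalars → Type
  | real => ℝ
  | complex => ℂ
  | quaternion => Quaternion ℝ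

/-- `β = 1, 2, 4`, the real dimension of `K`. -/
def β : Scalars → ℕ
  | real => 1
  | complex => 2
  | quaternion => 4

instance (F : Scalars) : DivisionRing F.K :=
  match F with
  | real => inferInstanceAs (DivisionRing ℝ)
  | complex => inferInstanceAs (DivisionRing ℂ)
  | quaternion => inferInstanceAs (DivisionRing (Quaternion ℝ))

instance (F : Scalars) : StarRing F.K :=
  match F with
  | real => inferInstanceAs (StarRing ℝ)
  | complex => inferInstanceAs (StarRing ℂ)
  | quaternion => inferInstanceAs (StarRing (Quaternion ℝ))

instance (F : Scalars) : Algebra ℝ F.K :=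
  match F with
  | real => inferInstanceAs (Algebra ℝ ℝ)
  | complex => inferInstanceAs (Algebra ℝ ℂ)
  | quaternion => inferInstanceAs (Algebra ℝ (Quaternion ℝ))

instance (F : Scalars) : StarModule ℝ F.K :=
  match F with
  | real => inferInstanceAs (StarModule ℝ ℝ)
  | complex => inferInstanceAs (StarModule ℝ ℂ)
  | quaternion => (⟨fun r q => Quaternion.star_smul r q⟩ : StarModule ℝ (Quaternion ℝ))

instance (F : Scalars) : FiniteDimensional ℝ F.K :=
  match F with
  | real => inferInstanceAs (FiniteDimensional ℝ ℝ)
  | complex => inferInstanceAs (FiniteDimensional ℝ ℂ)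
  | quaternion => inferInstanceAs (Module.Finite ℝ (Quaternion ℝ))

/-- The real part. -/
def re : (F : Scalars) → F.K →ₗ[ℝ] ℝ
  | real => (LinearMap.id : ℝ →ₗ[ℝ] ℝ)
  | complex => Complex.reLm
  | quaternion =>
    ({ toFun := fun q => q.re, map_add' := fun _ _ => rfl, map_smul' := fun _ _ => rfl } :
      Quaternion ℝ →ₗ[ℝ] ℝ)

theorem re_star (F : Scalars) (a : F.K) : F.re (star a) = F.re a := by
  cases F with
  | real => rfl
  | complex => exact Complex.conj_re a
  | quaternion => exact Quaternion.re_star (R := ℝ) a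

theorem complex_re_star_mul_self (z : ℂ) : (star z * z).re = Complex.normSq z := by
  simp [Complex.normSq_apply]

theorem quaternion_re_star_mul_self (q : Quaternion ℝ) :
    (star q * q).re = Quaternion.normSq q := by
  rw [Quaternion.star_mul_self]
  rfl

theorem re_star_mul_self_nonneg (F : Scalars) (a : F.K) : 0 ≤ F.re (star a * a) := by
  cases F with
  | real => exact mul_self_nonneg (R := ℝ) a
  | complex =>
    exact (Complex.normSq_nonneg a).trans_eq (complex_re_star_mul_self a).symm
  | quaternion =>
    exact (Quaternion.normSq_nonneg (a := a)).trans_eq (quaternion_re_star_mul_self a).symm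

theorem eq_zero_of_re_star_mul_self (F : Scalars) (a : F.K) (h : F.re (star a * a) = 0) :
    a = 0 := by
  cases F with
  | real => exact (mul_self_eq_zero (M₀ := ℝ)).1 h
  | complex => exact Complex.normSq_eq_zero.1 ((complex_re_star_mul_self a).symm.trans h)
  | quaternion =>
    exact (Quaternion.normSq_eq_zero (a := a)).1 ((quaternion_re_star_mul_self a).symm.trans h)

end Scalars

/-- The real vector space of `N × N` Hermitian matrices with entries in `K`. -/
def Herm (F : Scalars) (N : ℕ) : Type := selfAdjoint (Matrix (Fin N) (Fin N) F.K)

namespace Herm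

variable {F : Scalars} {N : ℕ}

instance : AddCommGroup (Herm F N) :=
  inferInstanceAs (AddCommGroup (selfAdjoint (Matrix (Fin N) (Fin N) F.K)))

instance : Module ℝ (Herm F N) :=
  inferInstanceAs (Module ℝ (selfAdjoint (Matrix (Fin N) (Fin N) F.K)))

instance : One (Herm F N) :=
  inferInstanceAs (One (selfAdjoint (Matrix (Fin N) (Fin N) F.K)))

/-- The underlying matrix. -/
def mat : Herm F N →ₗ[ℝ] Matrix (Fin N) (Fin N) F.K where
  toFun x := x.1
  map_add' _ _ := rfl
  map_smul' _ _ := rfl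

theorem mat_injective : Function.Injective (mat : Herm F N → Matrix (Fin N) (Fin N) F.K) :=
  Subtype.val_injective

theorem conjTranspose_mat (x : Herm F N) : (mat x)ᴴ = mat x := x.2

instance : FiniteDimensional ℝ (Herm F N) :=
  FiniteDimensional.of_injective (mat : Herm F N →ₗ[ℝ] _) mat_injective

/-- The trace scalar product `⟨u, v⟩ = tr(u v)` (its real part, for quaternions). -/
@[reducible]
def core : InnerProductSpace.Core ℝ (Herm F N) where
  inner u v := F.re (Matrix.trace (mat u * mat v))
  conj_inner_symm u v := by
    change F.re (Matrix.trace (mat v * mat u)) = F.re (Matrix.trace (mat u * mat v))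
    rw [← F.re_star, ← Matrix.trace_conjTranspose, Matrix.conjTranspose_mul,
      conjTranspose_mat, conjTranspose_mat]
  re_inner_nonneg u := by
    change 0 ≤ F.re (Matrix.trace (mat u * mat u))
    nth_rewrite 1 [← conjTranspose_mat u]
    simp only [Matrix.trace, Matrix.diag, Matrix.mul_apply, Matrix.conjTranspose_apply, map_sum]
    exact Finset.sum_nonneg fun i _ => Finset.sum_nonneg fun j _ => F.re_star_mul_self_nonneg _
  add_left u v w := by simp [add_mul]
  smul_left u v c := by simp
  definite u h := by
    change F.re (Matrix.trace (mat u * mat u)) = 0 at h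
    nth_rewrite 1 [← conjTranspose_mat u] at h
    simp only [Matrix.trace, Matrix.diag, Matrix.mul_apply, Matrix.conjTranspose_apply,
      map_sum] at h
    apply mat_injective
    ext i j
    rw [Finset.sum_eq_zero_iff_of_nonneg fun i _ =>
      Finset.sum_nonneg fun j _ => F.re_star_mul_self_nonneg _] at h
    have h1 := h j (Finset.mem_univ _)
    rw [Finset.sum_eq_zero_iff_of_nonneg fun i _ => F.re_star_mul_self_nonneg _] at h1
    simpa using F.eq_zero_of_re_star_mul_self _ (h1 i (Finset.mem_univ _))

instance : NormedAddCommGroup (Herm F N) := (core (F := F) (N := N)).toNormedAddCommGroup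

instance : InnerProductSpace ℝ (Herm F N) := InnerProductSpace.ofCore core.toCore

instance : MeasurableSpace (Herm F N) := borel _

instance : BorelSpace (Herm F N) := ⟨rfl⟩

theorem inner_eq (u v : Herm F N) : inner ℝ u v = F.re (Matrix.trace (mat u * mat v)) := rfl

end Herm

/-- The space `M` of `N × N` covariance matrices with entries in `K`: positive definite Hermitian
matrices. -/
def covMatrices (F : Scalars) (N : ℕ) : Set (Herm F N) :=
  {x | ∀ v : Fin N → F.K, v ≠ 0 → 0 < F.re (star v ⬝ᵥ (Herm.mat x *ᵥ v))}

/-- The affine-invariant metric `⟨u, v⟩_x = tr(x⁻¹ u x⁻¹ v)` (its real part, for quaternions). -/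
def affineMetric (F : Scalars) (N : ℕ) (x u v : Herm F N) : ℝ :=
  F.re (Matrix.trace (Ring.inverse (Herm.mat x) * Herm.mat u *
    Ring.inverse (Herm.mat x) * Herm.mat v))

/-- At the identity matrix the affine-invariant metric is the scalar product of `Herm F N`. -/
theorem affineMetric_one (F : Scalars) (N : ℕ) (u v : Herm F N) :
    affineMetric F N 1 u v = inner ℝ u v := by
  have h : Herm.mat (1 : Herm F N) = 1 := rfl
  simp [affineMetric, Herm.inner_eq, h]

/-- `ς` lists the (real) eigenvalues of `s` with multiplicities: `s = k ς k⁻¹` with `k` unitary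
(`k k† = k† k = id`) and `ς` real diagonal. -/
def IsEigenvalues {F : Scalars} {N : ℕ} (s : Herm F N) (ς : Fin N → ℝ) : Prop :=
  ∃ k : Matrix (Fin N) (Fin N) F.K, k * kᴴ = 1 ∧ kᴴ * k = 1 ∧
    Herm.mat s = k * Matrix.diagonal (fun i => algebraMap ℝ F.K (ς i)) * kᴴ

/-- `κ_ij = (ς_i - ς_j) / 2`. -/
def kappa {N : ℕ} (ς : Fin N → ℝ) (i j : Fin N) : ℝ := (ς i - ς j) / 2

/-- `sinh(κ r) / κ`, with its limit value `r` at `κ = 0`. -/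
def sinhRatio (κ r : ℝ) : ℝ := if κ = 0 then r else Real.sinh (κ * r) / κ

/-- The eigenvalues of the radial curvature operator: `0`, `N` times, and `-κ_ij²`, `β` times for
each `i < j`. -/
def principalCurvature {N m : ℕ} (ς : Fin N → ℝ) :
    Fin N ⊕ ({p : Fin N × Fin N // p.1 < p.2} × Fin m) → ℝ :=
  Sum.elim (fun _ => 0) fun q => -kappa ς q.1.1.1 q.1.1.2 ^ 2

end

/-! The space `M` is homogeneous. For x in `M` the map u ↦ x^(-1/2) u x^(-1/2) carries the metric at
x to Re tr(uv) (`Herm.affineMetric_exp`) and intertwines the curvature tensors at x and at the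
identity (`Herm.congruence_curvature`). So curvature only has to be understood at the identity,
where R(u,v)w = -¼[[u,v],w] (a special case of `Herm.toMat_curvature`) and the radial curvature
operator is -¼ ad_s².

Write s = k diag(ς) k†. Then ad_s kills k diag(·) k† and multiplies k(q E_ij)k† by ς_i - ς_j and its
adjoint by ς_j - ς_i. Taking Hermitian parts gives an orthonormal basis of eigenvectors with
eigenvalues 0 and -κ_ij² (`Herm.exists_adapted_orthonormalBasis`, `Herm.radialCurvature_of_eigen`).
The curvature bound is then (ς_i - ς_j)² ≤ 2(ς_i² + ς_j²) ≤ 2, with equality for the eigenvalues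
±1/√2.

Geodesics from the identity are t ↦ exp(ts), and parallel transport along them is v ↦ e^(ts/2) v
e^(ts/2). Transported back to the identity, the velocity and all parallel fields are constant, so
the curvature matrix in a parallel frame does not depend on r (`Herm.curvature_along`). The Jacobi
equation therefore decouples into scalar equations y'' = κ²y, solved by sinh(κr)/κ
(`Herm.det_of_isJacobiMatrix`).

For the volume formula no theory of Jacobi fields is used. The exponential is a smooth bijection
from Hermitian matrices onto `M`, and its derivative is computed algebraically: on the same
eigenvectors, e^(-y/2) dexp_y(·) e^(-y/2) has the eigenvalues sinh(κ)/κ, with κ formed from the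
eigenvalues of y (`Herm.congruence_fderiv_exp_of_eigen`). The change of variables formula and
Euclidean polar coordinates, whose factor r^(d-1) is shared among the d-1 eigenvalues other than
that of s, then yield |det A|.

All three scalar types are treated at once. Over the quaternions the trace is not cyclic but its
real part is, and the spectral theorem is obtained by a variational argument
(`Mat.exists_unitary_eq_diag`). -/

noncomputable section

/-! ### Scalars as real normed algebras, and the matrix algebra over them -/

namespace Scalars

theorem quaternion_re_mul_comm (a b : Quaternion ℝ) : (a * b).re = (b * a).re := by
  rw [Quaternion.re_mul, Quaternion.re_mul]
  ring

theorem quaternion_re_star_mul (a b : Quaternion ℝ) : (star a * b).re =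
    a.re * b.re + a.imI * b.imI + a.imJ * b.imJ + a.imK * b.imK := by
  rw [Quaternion.re_mul, Quaternion.re_star, Quaternion.imI_star, Quaternion.imJ_star,
    Quaternion.imK_star]
  ring

variable (F : Scalars)

theorem re_mul_comm (a b : F.K) : F.re (a * b) = F.re (b * a) := by
  cases F with
  | real => exact mul_comm (G := ℝ) a b
  | complex => exact congrArg Complex.re (mul_comm (G := ℂ) a b)
  | quaternion =>
    exact quaternion_re_mul_comm a b

theorem re_one : F.re 1 = 1 := by
  cases F <;> rfl

theorem re_algebraMap (r : ℝ) : F.re (algebraMap ℝ F.K r) = r := by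
  rw [Algebra.algebraMap_eq_smul_one, map_smul, re_one, smul_eq_mul, mul_one]

theorem eq_algebraMap_of_star_eq {a : F.K} (h : star a = a) : a = algebraMap ℝ F.K (F.re a) := by
  cases F with
  | real => rfl
  | complex => exact (Complex.conj_eq_iff_re.1 h).symm
  | quaternion => exact Quaternion.star_eq_self.1 h

theorem star_mul_self_eq (a : F.K) : star a * a = algebraMap ℝ F.K (F.re (star a * a)) :=
  F.eq_algebraMap_of_star_eq (by simp)

theorem star_algebraMap (r : ℝ) : star (algebraMap ℝ F.K r) = algebraMap ℝ F.K r := by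
  simp [Algebra.algebraMap_eq_smul_one]

/-- The scalar product `re (a† b)` of `K`. -/
@[reducible]
def core : InnerProductSpace.Core ℝ F.K where
  inner a b := F.re (star a * b)
  conj_inner_symm a b := by
    change F.re (star b * a) = F.re (star a * b)
    rw [← F.re_star]
    simp
  re_inner_nonneg a := F.re_star_mul_self_nonneg a
  add_left a b c := by simp [add_mul]
  smul_left a b r := by simp
  definite a h := F.eq_zero_of_re_star_mul_self a h

instance : NormedAddCommGroup F.K := F.core.toNormedAddCommGroup

instance : InnerProductSpace ℝ F.K := InnerProductSpace.ofCore F.core.toCore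

theorem inner_def (a b : F.K) : inner ℝ a b = F.re (star a * b) := rfl

theorem norm_sq (a : F.K) : ‖a‖ ^ 2 = F.re (star a * a) := by
  rw [← real_inner_self_eq_norm_sq, inner_def]

/-- The product a†a is real, hence central, so it can be pulled out of b†(a†a)b even over the
quaternions. -/
theorem norm_mul_eq (a b : F.K) : ‖a * b‖ = ‖a‖ * ‖b‖ := by
  refine (sq_eq_sq₀ (norm_nonneg _) (by positivity)).1 ?_
  rw [mul_pow, norm_sq, norm_sq, norm_sq, star_mul, mul_assoc, ← mul_assoc (star a),
    F.star_mul_self_eq a, ← Algebra.smul_def, mul_smul_comm, map_smul, re_algebraMap, smul_eq_mul]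

instance : NormedRing F.K :=
  { (inferInstance : NormedAddCommGroup F.K), (inferInstance : DivisionRing F.K) with
    norm_mul_le := fun a b => (F.norm_mul_eq a b).le }

instance : NormedAlgebra ℝ F.K where
  norm_smul_le r a := (norm_smul r a).le

/-- The quaternion units `1, i, j, k`. -/
def quaternionUnit : Fin 4 → Quaternion ℝ :=
  ![⟨1, 0, 0, 0⟩, ⟨0, 1, 0, 0⟩, ⟨0, 0, 1, 0⟩, ⟨0, 0, 0, 1⟩]

theorem re_star_complexUnit_mul (m n : Fin 2) :
    (star ((![1, Complex.I] : Fin 2 → ℂ) m) * (![1, Complex.I] : Fin 2 → ℂ) n).re =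
      if m = n then 1 else 0 := by
  fin_cases m <;> fin_cases n <;> simp

theorem re_star_quaternionUnit_mul (m n : Fin 4) :
    (star (quaternionUnit m) * quaternionUnit n).re = if m = n then 1 else 0 := by
  rw [quaternion_re_star_mul]
  fin_cases m <;> fin_cases n <;> simp [quaternionUnit]

theorem complex_eq_zero_of_re_star_unit_mul (a : ℂ)
    (h : ∀ m, (star ((![1, Complex.I] : Fin 2 → ℂ) m) * a).re = 0) : a = 0 := by
  have h0 := h 0
  have h1 := h 1
  apply Complex.ext
  · simpa using h0
  · simpa using h1

theorem quaternion_eq_zero_of_re_star_unit_mul (a : Quaternion ℝ)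
    (h : ∀ m, (star (quaternionUnit m) * a).re = 0) : a = 0 := by
  have h0 := h 0
  have h1 := h 1
  have h2 := h 2
  have h3 := h 3
  rw [quaternion_re_star_mul] at h0 h1 h2 h3
  apply Quaternion.ext
  · exact (by simpa [quaternionUnit] using h0 : a.re = 0)
  · exact (by simpa [quaternionUnit] using h1 : a.imI = 0)
  · exact (by simpa [quaternionUnit] using h2 : a.imJ = 0)
  · exact (by simpa [quaternionUnit] using h3 : a.imK = 0)

/-- The real orthonormal basis `1`, or `1, i`, or `1, i, j, k`, of `K`. -/
def unit : (F : Scalars) → Fin F.β → F.K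
  | real => fun _ => (1 : ℝ)
  | complex => (![1, Complex.I] : Fin 2 → ℂ)
  | quaternion => quaternionUnit

theorem re_star_unit_mul_unit (m n : Fin F.β) :
    F.re (star (F.unit m) * F.unit n) = if m = n then 1 else 0 := by
  cases F with
  | real =>
    rw [Subsingleton.elim (α := Fin 1) m n, if_pos rfl]
    exact mul_one (1 : ℝ)
  | complex => exact re_star_complexUnit_mul m n
  | quaternion => exact re_star_quaternionUnit_mul m n

theorem eq_zero_of_re_star_unit_mul {a : F.K} (h : ∀ m, F.re (star (F.unit m) * a) = 0) :
    a = 0 := by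
  cases F with
  | real => exact (one_mul (M := ℝ) a).symm.trans (h (0 : Fin 1))
  | complex => exact complex_eq_zero_of_re_star_unit_mul a h
  | quaternion => exact quaternion_eq_zero_of_re_star_unit_mul a h

end Scalars

/-- The real Banach algebra of `N × N` matrices with entries in `K`. -/
def Mat (F : Scalars) (N : ℕ) : Type := Matrix (Fin N) (Fin N) F.K

namespace Mat

variable {F : Scalars} {N : ℕ}

instance : NormedRing (Mat F N) := Matrix.linftyOpNormedRing

instance : NormedAlgebra ℝ (Mat F N) := Matrix.linftyOpNormedAlgebra

instance : StarRing (Mat F N) := inferInstanceAs (StarRing (Matrix (Fin N) (Fin N) F.K))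

instance : StarModule ℝ (Mat F N) := inferInstanceAs (StarModule ℝ (Matrix (Fin N) (Fin N) F.K))

instance : FiniteDimensional ℝ (Mat F N) :=
  inferInstanceAs (Module.Finite ℝ (Matrix (Fin N) (Fin N) F.K))

instance : CompleteSpace (Mat F N) := FiniteDimensional.complete ℝ _

/-- The adjoint as a continuous linear map. -/
def starL : Mat F N →L[ℝ] Mat F N :=
  LinearMap.toContinuousLinearMap
    { toFun := star, map_add' := star_add, map_smul' := fun r a => by simp }

instance : ContinuousStar (Mat F N) := ⟨(starL (F := F) (N := N)).continuous⟩

instance : NormedAlgebra ℚ (Mat F N) := NormedAlgebra.restrictScalars ℚ ℝ _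

/-- The real part of the trace. -/
def tr : Mat F N →L[ℝ] ℝ :=
  LinearMap.toContinuousLinearMap (F.re ∘ₗ Matrix.traceLinearMap (Fin N) ℝ F.K)

theorem tr_apply (a : Mat F N) : tr a = F.re (Matrix.trace (R := F.K) (n := Fin N) a) := rfl

/-- Cyclicity comes from re(ab) = re(ba) entry by entry. Over the quaternions it is available only
after taking the real part. -/
theorem tr_mul_comm (a b : Mat F N) : tr (a * b) = tr (b * a) := by
  have h (c d : Matrix (Fin N) (Fin N) F.K) :
      F.re (Matrix.trace (c * d)) = ∑ i, ∑ j, F.re (c i j * d j i) := by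
    simp only [Matrix.trace, Matrix.diag, Matrix.mul_apply, map_sum]
  refine (h a b).trans (Eq.trans ?_ (h b a).symm)
  rw [Finset.sum_comm]
  simp only [F.re_mul_comm]

theorem tr_star (a : Mat F N) : tr (star a) = tr a := by
  rw [tr_apply, tr_apply]
  exact (congrArg F.re (Matrix.trace_conjTranspose (R := F.K) a)).trans (F.re_star _)

theorem tr_star_mul_self (a : Mat F N) :
    tr (star a * a) = ∑ i, ∑ j, F.re (star (a j i) * a j i) := by
  have h (c d : Matrix (Fin N) (Fin N) F.K) :
      F.re (Matrix.trace (cᴴ * d)) = ∑ i, ∑ j, F.re (star (c j i) * d j i) := by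
    simp only [Matrix.trace, Matrix.diag, Matrix.mul_apply, map_sum, Matrix.conjTranspose_apply]
  exact h a a

theorem eq_zero_of_tr_star_mul_self {a : Mat F N} (h : tr (star a * a) = 0) : a = 0 := by
  rw [tr_star_mul_self, Finset.sum_eq_zero_iff_of_nonneg fun i _ =>
      Finset.sum_nonneg fun j _ => F.re_star_mul_self_nonneg _] at h
  refine Matrix.ext fun i j => ?_
  have h1 := h j (Finset.mem_univ _)
  rw [Finset.sum_eq_zero_iff_of_nonneg fun i _ => F.re_star_mul_self_nonneg _] at h1
  exact F.eq_zero_of_re_star_mul_self _ (h1 i (Finset.mem_univ _))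

/-- The real diagonal matrices. -/
def diag (ς : Fin N → ℝ) : Mat F N := Matrix.diagonal fun i => algebraMap ℝ F.K (ς i)

theorem diag_mul_apply (ς : Fin N → ℝ) (a : Mat F N) (i j : Fin N) :
    (diag ς * a : Mat F N) i j = ς i • a i j :=
  (Matrix.diagonal_mul (α := F.K) (fun i => algebraMap ℝ F.K (ς i)) a i j).trans
    (Algebra.smul_def (ς i) (a i j)).symm

theorem mul_diag_apply (ς : Fin N → ℝ) (a : Mat F N) (i j : Fin N) :
    (a * diag ς : Mat F N) i j = ς j • a i j :=
  (Matrix.mul_diagonal (α := F.K) (fun i => algebraMap ℝ F.K (ς i)) a i j).trans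
    ((Algebra.commutes (ς j) (a i j)).symm.trans (Algebra.smul_def (ς j) (a i j)).symm)

theorem star_diag (ς : Fin N → ℝ) : star (diag ς : Mat F N) = diag ς := by
  refine (Matrix.diagonal_conjTranspose (α := F.K) _).trans ?_
  exact congrArg Matrix.diagonal (funext fun i => F.star_algebraMap (ς i))

theorem diag_mul_diag (ς τ : Fin N → ℝ) :
    (diag ς * diag τ : Mat F N) = diag fun i => ς i * τ i := by
  refine (Matrix.diagonal_mul_diagonal (α := F.K) _ _).trans ?_
  exact congrArg Matrix.diagonal (funext fun i => (map_mul (algebraMap ℝ F.K) (ς i) (τ i)).symm)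

theorem diag_one : (diag (fun _ => 1) : Mat F N) = 1 := by
  refine Eq.trans ?_ (Matrix.diagonal_one (α := F.K))
  exact congrArg Matrix.diagonal (funext fun i => map_one (algebraMap ℝ F.K))

end Mat

namespace Herm

variable {F : Scalars} {N : ℕ}

/-- The inclusion of the Hermitian matrices into all matrices. -/
def toMat : Herm F N →L[ℝ] Mat F N :=
  LinearMap.toContinuousLinearMap (mat : Herm F N →ₗ[ℝ] Matrix (Fin N) (Fin N) F.K)

theorem toMat_injective : Function.Injective (toMat : Herm F N → Mat F N) := mat_injective

theorem star_toMat (x : Herm F N) : star (toMat x) = toMat x := x.2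

theorem toMat_one : toMat (1 : Herm F N) = 1 := rfl

/-- The Hermitian part `(a + a†) / 2`. -/
def ofMat : Mat F N →L[ℝ] Herm F N :=
  LinearMap.toContinuousLinearMap
    { toFun := fun a => (⟨(2⁻¹ : ℝ) • (a + star a), by
        refine selfAdjoint.mem_iff.2 ?_
        exact (star_smul (2⁻¹ : ℝ) (a + star a)).trans (by simp [add_comm])⟩ :
          selfAdjoint (Matrix (Fin N) (Fin N) F.K))
      map_add' := fun a b => toMat_injective (by
        change (2⁻¹ : ℝ) • (a + b + star (a + b)) =
          (2⁻¹ : ℝ) • (a + star a) + (2⁻¹ : ℝ) • (b + star b)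
        rw [star_add, ← smul_add]
        congr 1
        abel)
      map_smul' := fun r a => toMat_injective (by
        change (2⁻¹ : ℝ) • (r • a + star (r • a)) = r • (2⁻¹ : ℝ) • (a + star a)
        rw [star_smul, star_trivial, ← smul_add, smul_comm]) }

theorem toMat_ofMat (a : Mat F N) : toMat (ofMat a) = (2⁻¹ : ℝ) • (a + star a) := rfl

theorem toMat_ofMat_of_star_eq {a : Mat F N} (h : star a = a) : toMat (ofMat a) = a := by
  rw [toMat_ofMat, h, ← two_smul ℝ, smul_smul]
  norm_num

@[simp] theorem ofMat_toMat (x : Herm F N) : ofMat (toMat x) = x :=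
  toMat_injective (toMat_ofMat_of_star_eq (star_toMat x))

theorem inner_eq_tr (u v : Herm F N) : inner ℝ u v = Mat.tr (toMat u * toMat v) := rfl

end Herm

theorem isEigenvalues_iff {F : Scalars} {N : ℕ} {s : Herm F N} {ς : Fin N → ℝ} :
    IsEigenvalues s ς ↔ ∃ k : Mat F N, k * star k = 1 ∧ star k * k = 1 ∧
      Herm.toMat s = k * Mat.diag ς * star k := Iff.rfl

end

/-! ### The spectral theorem for Hermitian matrices over K -/

noncomputable section

namespace Mat

variable {F : Scalars} {N : ℕ}

theorem star_apply (a : Mat F N) (i j : Fin N) : (star a : Mat F N) i j = star (a j i) := rfl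

/-- Each entry satisfies |k_ij|² ≤ Re tr(k†k) = Re tr 1, which bounds the row sums in the operator
norm. Compactness provides the maximizer in the spectral theorem. -/
theorem isCompact_unitary : IsCompact {k : Mat F N | k * star k = 1 ∧ star k * k = 1} := by
  have : ProperSpace (Mat F N) := FiniteDimensional.proper_real _
  refine Metric.isCompact_of_isClosed_isBounded ?_ ?_
  · exact (isClosed_eq (by fun_prop) continuous_const).inter
      (isClosed_eq (by fun_prop) continuous_const)
  · refine isBounded_iff_forall_norm_le.2
      ⟨((∑ _j : Fin N, Real.toNNReal √(tr (1 : Mat F N)) : NNReal) : ℝ), fun k hk => ?_⟩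
    refine (Matrix.linfty_opNorm_def (α := F.K) k).trans_le ?_
    refine NNReal.coe_le_coe.2 (Finset.sup_le fun i _ => Finset.sum_le_sum fun j _ => ?_)
    refine NNReal.le_toNNReal_of_coe_le (Real.le_sqrt_of_sq_le ?_)
    rw [coe_nnnorm, F.norm_sq, ← hk.2, tr_star_mul_self]
    refine (Finset.single_le_sum (f := fun i => F.re (star (k i j) * k i j))
      (fun i _ => F.re_star_mul_self_nonneg _) (Finset.mem_univ i)).trans ?_
    exact Finset.single_le_sum (f := fun j : Fin N => ∑ i : Fin N, F.re (star (k i j) * k i j))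
      (fun j _ => Finset.sum_nonneg fun i _ => F.re_star_mul_self_nonneg _) (Finset.mem_univ j)

theorem hasDerivAt_exp_smul (a : Mat F N) (t : ℝ) :
    HasDerivAt (fun t : ℝ => NormedSpace.exp (t • a)) (NormedSpace.exp (t • a) * a) t :=
  hasDerivAt_exp_smul_const a t

theorem star_exp_smul_of_skew {X : Mat F N} (hX : star X = -X) (t : ℝ) :
    star (NormedSpace.exp (t • X)) = NormedSpace.exp (-(t • X)) := by
  rw [NormedSpace.star_exp, star_smul, hX, star_trivial, smul_neg]

theorem exp_mul_exp_neg (a : Mat F N) : NormedSpace.exp a * NormedSpace.exp (-a) = 1 := by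
  rw [← NormedSpace.exp_add_of_commute ((Commute.refl a).neg_right), add_neg_cancel,
    NormedSpace.exp_zero]

theorem exp_neg_mul_exp (a : Mat F N) : NormedSpace.exp (-a) * NormedSpace.exp a = 1 := by
  simpa using exp_mul_exp_neg (-a)

/-- A unitary `k` maximizing `tr (c k† s k)`, with `c` diagonal with distinct entries,
diagonalizes `s`. -/
theorem exists_unitary_eq_diag (s : Mat F N) (hs : star s = s) :
    ∃ (k : Mat F N) (ς : Fin N → ℝ), k * star k = 1 ∧ star k * k = 1 ∧
      s = k * diag ς * star k := by
  obtain ⟨c, hcdef⟩ : ∃ c : Mat F N, c = diag fun i => (i : ℝ) := ⟨_, rfl⟩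
  obtain ⟨k, ⟨hk1, hk2⟩, hmax⟩ := (isCompact_unitary (F := F) (N := N)).exists_isMaxOn
    ⟨1, by simp⟩ (f := fun k => tr (c * (star k * s * k))) (by fun_prop)
  obtain ⟨d, hd⟩ : ∃ d : Mat F N, d = star k * s * k := ⟨_, rfl⟩
  have hds : star d = d := by simp [hd, hs, mul_assoc]
  have hc : star c = c := hcdef ▸ star_diag _
  -- The commutator of c and d is skew, hence a tangent direction to the unitary group. Along it the
  -- first variation at the maximum turns out to be Re tr(X²) = -Re tr(X†X).
  obtain ⟨X, hX⟩ : ∃ X : Mat F N, X = c * d - d * c := ⟨_, rfl⟩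
  have hXs : star X = -X := by simp [hX, hc, hds]
  have hder : HasDerivAt (fun t : ℝ => tr (c * (NormedSpace.exp (t • -X) * d *
      NormedSpace.exp (t • X)))) (tr (c * (-X * d + d * X))) 0 := by
    have h1 := ((hasDerivAt_exp_smul (-X) 0).mul_const d).mul (hasDerivAt_exp_smul X 0)
    have h2 := (tr (F := F) (N := N)).hasFDerivAt.comp_hasDerivAt (0 : ℝ) (h1.const_mul c)
    simpa [Function.comp_def] using! h2
  have hloc : IsLocalMax (fun t : ℝ => tr (c * (NormedSpace.exp (t • -X) * d *
      NormedSpace.exp (t • X)))) 0 := by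
    refine Filter.Eventually.of_forall fun t => ?_
    -- As X is skew, exp(tX) is unitary, so k exp(tX) is an admissible competitor.
    have hm := @hmax (k * NormedSpace.exp (t • X)) (by
      simp only [Set.mem_ofPred_eq, star_mul, star_exp_smul_of_skew hXs]
      constructor
      · rw [mul_assoc, ← mul_assoc (NormedSpace.exp (t • X)), exp_mul_exp_neg, one_mul, hk1]
      · rw [mul_assoc, ← mul_assoc (star k), hk2, one_mul, exp_neg_mul_exp])
    simp only [Set.mem_ofPred_eq, star_mul, star_exp_smul_of_skew hXs] at hm
    simpa [hd, mul_assoc] using hm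
  have hzero : tr (c * (-X * d + d * X)) = 0 := hloc.hasDerivAt_eq_zero hder
  have hXX : tr (star X * X) = 0 := by
    have h1 : tr (c * (-X * d + d * X)) = tr (X * X) := by
      have h2 : tr (c * (X * d)) = tr (d * c * X) := by
        rw [← mul_assoc, tr_mul_comm (c * X) d, mul_assoc]
      have h3 : X * X = c * d * X - d * c * X := by rw [← sub_mul, ← hX]
      rw [h3, map_sub, ← h2, neg_mul, mul_add, mul_neg, map_add, map_neg, mul_assoc]
      ring
    rw [hXs, neg_mul, map_neg, ← h1, hzero, neg_zero]
  -- Now d commutes with c, so (c_i - c_j) d_ij = 0. The entries 0, 1, …, N-1 of c are distinct,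
  -- which makes d diagonal, and self-adjointness makes its diagonal real.
  have hcd : c * d = d * c := sub_eq_zero.1 (hX ▸ eq_zero_of_tr_star_mul_self hXX)
  have hdd : d = diag fun i => F.re (d i i) := by
    refine Matrix.ext fun i j => ?_
    rcases eq_or_ne i j with rfl | hij
    · refine Eq.trans ?_ (Matrix.diagonal_apply_eq (α := F.K) _ i).symm
      exact F.eq_algebraMap_of_star_eq (congrFun (congrFun hds i) i)
    · rw [hcdef] at hcd
      refine Eq.trans ?_ (Matrix.diagonal_apply_ne (α := F.K) _ hij).symm
      have h := (diag_mul_apply _ d i j).symm.trans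
        ((congrFun (congrFun hcd i) j).trans (mul_diag_apply _ d i j))
      rw [← sub_eq_zero, ← sub_smul] at h
      refine (smul_eq_zero.1 h).resolve_left ?_
      refine sub_ne_zero.2 ?_
      exact_mod_cast Fin.val_ne_of_ne hij
  refine ⟨k, fun i => F.re (d i i), hk1, hk2, ?_⟩
  rw [← hdd, hd]
  simp only [mul_assoc, hk1, mul_one]
  rw [← mul_assoc k, hk1, one_mul]

end Mat

theorem exists_isEigenvalues {F : Scalars} {N : ℕ} (s : Herm F N) : ∃ ς, IsEigenvalues s ς := by
  obtain ⟨k, ς, h1, h2, h3⟩ := Mat.exists_unitary_eq_diag (Herm.toMat s) (Herm.star_toMat s)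
  exact ⟨ς, isEigenvalues_iff.2 ⟨k, h1, h2, h3⟩⟩

end

/-! ### Positive definite matrices as the bijective image of the exponential -/

noncomputable section

namespace Mat

variable {F : Scalars} {N : ℕ}

/-- `Mat.diag` as a ring homomorphism. -/
def diagHom : (Fin N → ℝ) →+* Mat F N where
  toFun := diag
  map_one' := diag_one
  map_mul' ς τ := (diag_mul_diag ς τ).symm
  map_zero' := by
    refine Eq.trans ?_ (Matrix.diagonal_zero (α := F.K))
    exact congrArg Matrix.diagonal (funext fun i => map_zero (algebraMap ℝ F.K))
  map_add' ς τ := by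
    refine Eq.trans ?_ (Matrix.diagonal_add (α := F.K) _ _).symm
    exact congrArg Matrix.diagonal (funext fun i => map_add (algebraMap ℝ F.K) _ _)

theorem diag_smul (r : ℝ) (ς : Fin N → ℝ) : (diag (r • ς) : Mat F N) = r • diag ς := by
  refine Eq.trans ?_ (Matrix.diagonal_smul (α := F.K) r _)
  refine congrArg Matrix.diagonal (funext fun i => ?_)
  exact (map_mul (algebraMap ℝ F.K) _ _).trans (Algebra.smul_def _ _).symm

theorem continuous_diag : Continuous (diag : (Fin N → ℝ) → Mat F N) :=
  LinearMap.continuous_of_finiteDimensional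
    ({ toFun := diag, map_add' := (diagHom (F := F)).map_add, map_smul' := diag_smul } :
      (Fin N → ℝ) →ₗ[ℝ] Mat F N)

theorem exp_diag (ς : Fin N → ℝ) :
    NormedSpace.exp (diag ς : Mat F N) = diag fun i => Real.exp (ς i) := by
  have h := NormedSpace.map_exp (diagHom (F := F) (N := N)) continuous_diag ς
  refine h.symm.trans (congrArg diag (funext fun i => ?_))
  rw [Pi.coe_exp, Real.exp_eq_exp_ℝ]

theorem exp_conj {k : Mat F N} (h1 : k * star k = 1) (h2 : star k * k = 1) (a : Mat F N) :
    NormedSpace.exp (k * a * star k) = k * NormedSpace.exp a * star k :=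
  NormedSpace.exp_units_conj (⟨k, star k, h1, h2⟩ : (Mat F N)ˣ) a

theorem tr_diag (ς : Fin N → ℝ) : tr (diag ς : Mat F N) = ∑ i, ς i := by
  rw [tr_apply]
  have h : Matrix.trace (diag ς : Matrix (Fin N) (Fin N) F.K) = ∑ i, algebraMap ℝ F.K (ς i) :=
    Matrix.trace_diagonal _
  rw [h, map_sum]
  simp only [F.re_algebraMap]

/-- The quadratic form `re (v† a v)`. -/
def quad (a : Mat F N) (v : Fin N → F.K) : ℝ :=
  F.re (star v ⬝ᵥ Matrix.mulVec (α := F.K) (n := Fin N) (m := Fin N) a v)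

theorem quad_add (a b : Mat F N) (v : Fin N → F.K) : quad (a + b) v = quad a v + quad b v := by
  have h : Matrix.mulVec (α := F.K) (n := Fin N) (m := Fin N) (a + b) v =
    Matrix.mulVec (α := F.K) (n := Fin N) (m := Fin N) a v +
      Matrix.mulVec (α := F.K) (n := Fin N) (m := Fin N) b v := Matrix.add_mulVec _ _ _
  rw [quad, h, dotProduct_add, map_add]
  rfl

theorem quad_diag (ς : Fin N → ℝ) (v : Fin N → F.K) :
    quad (diag ς) v = ∑ i, ς i * F.re (star (v i) * v i) := by
  have h (w : Fin N → F.K) : F.re (star v ⬝ᵥ Matrix.mulVec (Matrix.diagonal w) v) =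
      ∑ i, F.re (star (v i) * (w i * v i)) := by
    simp [dotProduct, Matrix.mulVec_diagonal]
  refine (h _).trans (Finset.sum_congr rfl fun i _ => ?_)
  rw [← Algebra.smul_def, mul_smul_comm, map_smul, smul_eq_mul]

theorem quad_conj (k a : Mat F N) (v : Fin N → F.K) :
    quad (k * a * star k) v =
      quad a (Matrix.mulVec (α := F.K) (n := Fin N) (m := Fin N) (star k) v) := by
  have h (k a : Matrix (Fin N) (Fin N) F.K) :
      star v ⬝ᵥ (k * a * kᴴ) *ᵥ v = star (kᴴ *ᵥ v) ⬝ᵥ (a *ᵥ (kᴴ *ᵥ v)) := by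
    rw [Matrix.star_mulVec, Matrix.conjTranspose_conjTranspose, ← Matrix.mulVec_mulVec,
      ← Matrix.mulVec_mulVec, Matrix.dotProduct_mulVec]
  exact congrArg F.re (h k a)

theorem quad_one (v : Fin N → F.K) : quad (1 : Mat F N) v = ∑ i, F.re (star (v i) * v i) := by
  rw [← diag_one, quad_diag]
  simp

theorem quad_one_pos {v : Fin N → F.K} (hv : v ≠ 0) : 0 < quad (1 : Mat F N) v := by
  rw [quad_one]
  refine lt_of_le_of_ne (Finset.sum_nonneg fun i _ => F.re_star_mul_self_nonneg _) fun h => hv ?_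
  have h' := (Finset.sum_eq_zero_iff_of_nonneg fun i _ => F.re_star_mul_self_nonneg _).1 h.symm
  exact funext fun i => F.eq_zero_of_re_star_mul_self _ (h' i (Finset.mem_univ _))

end Mat

variable {F : Scalars} {N : ℕ}

theorem mem_covMatrices_iff {x : Herm F N} :
    x ∈ covMatrices F N ↔ ∀ v : Fin N → F.K, v ≠ 0 → 0 < Mat.quad (Herm.toMat x) v := Iff.rfl

theorem IsEigenvalues.norm_sq {s : Herm F N} {ς : Fin N → ℝ} (h : IsEigenvalues s ς) :
    ‖s‖ ^ 2 = ∑ i, ς i ^ 2 := by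
  obtain ⟨k, h1, h2, h3⟩ := isEigenvalues_iff.1 h
  rw [← real_inner_self_eq_norm_sq, Herm.inner_eq_tr, h3]
  have : k * Mat.diag ς * star k * (k * Mat.diag ς * star k) =
      k * (Mat.diag ς * Mat.diag ς * star k) := by
    simp only [mul_assoc]
    rw [← mul_assoc (star k) k, h2, one_mul]
  rw [this, Mat.tr_mul_comm, mul_assoc, h2, mul_one, Mat.diag_mul_diag, Mat.tr_diag]
  simp only [sq]

/-- The vector is w = k†v: in the eigenbasis the quadratic form is a weighted sum of squares with
the same total mass. -/
theorem IsEigenvalues.quad_eq {s : Herm F N} {ς : Fin N → ℝ} (h : IsEigenvalues s ς)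
    (v : Fin N → F.K) : ∃ w : Fin N → F.K, Mat.quad (1 : Mat F N) w = Mat.quad (1 : Mat F N) v ∧
      Mat.quad (Herm.toMat s) v = ∑ i, ς i * F.re (star (w i) * w i) := by
  obtain ⟨k, h1, h2, h3⟩ := isEigenvalues_iff.1 h
  refine ⟨Matrix.mulVec (α := F.K) (n := Fin N) (m := Fin N) (star k) v, ?_, ?_⟩
  · rw [← Mat.quad_conj, mul_one, h1]
  · rw [h3, Mat.quad_conj, Mat.quad_diag]

theorem IsEigenvalues.exists_quad_eq {s : Herm F N} {ς : Fin N → ℝ} (h : IsEigenvalues s ς)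
    (i : Fin N) : ∃ v : Fin N → F.K, v ≠ 0 ∧ Mat.quad (Herm.toMat s) v = ς i := by
  obtain ⟨k, h1, h2, h3⟩ := isEigenvalues_iff.1 h
  have hk : Matrix.mulVec (α := F.K) (n := Fin N) (m := Fin N) (star k)
      (Matrix.mulVec (α := F.K) (n := Fin N) (m := Fin N) k (Pi.single i 1)) = Pi.single i 1 := by
    refine (Matrix.mulVec_mulVec (α := F.K) _ (star k) k).trans ?_
    refine Eq.trans ?_ (Matrix.one_mulVec (α := F.K) _)
    exact congrArg (fun a : Matrix (Fin N) (Fin N) F.K => a *ᵥ (Pi.single i 1)) h2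
  have hval : Mat.quad (Herm.toMat s)
      (Matrix.mulVec (α := F.K) (n := Fin N) (m := Fin N) k (Pi.single i 1)) = ς i := by
    rw [h3, Mat.quad_conj, hk, Mat.quad_diag, Finset.sum_eq_single i]
    · simp [F.re_one]
    · intro j _ hj
      simp [Pi.single_eq_of_ne hj]
    · simp
  refine ⟨_, fun h0 => ?_, hval⟩
  rw [h0] at hk
  have := congrFun
    ((Matrix.mulVec_zero (α := F.K) (n := Fin N) (m := Fin N) (star k)).symm.trans hk) i
  simp at this

theorem mem_covMatrices_iff_of_isEigenvalues {s : Herm F N} {ς : Fin N → ℝ}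
    (h : IsEigenvalues s ς) : s ∈ covMatrices F N ↔ ∀ i, 0 < ς i := by
  rw [mem_covMatrices_iff]
  constructor
  · intro hs i
    obtain ⟨v, hv, hvi⟩ := h.exists_quad_eq i
    exact hvi ▸ hs v hv
  · intro hς v hv
    obtain ⟨w, hw, hvw⟩ := h.quad_eq v
    rw [hvw]
    have hpos := Mat.quad_one_pos hv
    rw [← hw, Mat.quad_one] at hpos
    obtain ⟨i, hi, hi'⟩ := Finset.exists_lt_of_sum_lt (f := fun _ => (0 : ℝ))
      (by simpa using hpos)
    exact Finset.sum_pos' (fun j _ => mul_nonneg (hς j).le (F.re_star_mul_self_nonneg _))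
      ⟨i, hi, mul_pos (hς i) hi'⟩

theorem IsEigenvalues.abs_le_norm {s : Herm F N} {ς : Fin N → ℝ} (h : IsEigenvalues s ς)
    (i : Fin N) : |ς i| ≤ ‖s‖ := by
  refine abs_le_of_sq_le_sq ?_ (norm_nonneg _)
  rw [h.norm_sq]
  exact Finset.single_le_sum (f := fun i => ς i ^ 2) (fun j _ => sq_nonneg _) (Finset.mem_univ i)

theorem quad_ge (u : Herm F N) (v : Fin N → F.K) :
    -‖u‖ * Mat.quad (1 : Mat F N) v ≤ Mat.quad (Herm.toMat u) v := by
  obtain ⟨τ, hτ⟩ := exists_isEigenvalues u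
  obtain ⟨w, hw, hvw⟩ := hτ.quad_eq v
  rw [hvw, ← hw, Mat.quad_one, Finset.mul_sum]
  exact Finset.sum_le_sum fun i _ => mul_le_mul_of_nonneg_right
    (neg_le_of_abs_le (hτ.abs_le_norm i)) (F.re_star_mul_self_nonneg _)

/-- The form of x is at least its smallest eigenvalue times |v|², and by `quad_ge` a perturbation of
smaller norm cannot destroy positivity. -/
theorem isOpen_covMatrices : IsOpen (covMatrices F N) := by
  -- For N = 0 there is no smallest eigenvalue, and the condition is vacuous.
  rcases isEmpty_or_nonempty (Fin N) with hN | hN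
  · convert isOpen_univ (X := Herm F N)
    exact Set.eq_univ_of_forall fun x v hv => (hv (Subsingleton.elim _ _)).elim
  rw [Metric.isOpen_iff]
  intro x hx
  obtain ⟨ς, hς⟩ := exists_isEigenvalues x
  have hpos := (mem_covMatrices_iff_of_isEigenvalues hς).1 hx
  obtain ⟨i, hi⟩ := exists_eq_ciInf_of_finite (f := ς)
  refine ⟨ς i, hpos i, fun y hy v hv => ?_⟩
  have hsplit : Mat.quad (Herm.toMat y) v =
      Mat.quad (Herm.toMat x) v + Mat.quad (Herm.toMat (y - x)) v := by
    rw [← Mat.quad_add, ← map_add, add_sub_cancel]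
  have h1 : ς i * Mat.quad (1 : Mat F N) v ≤ Mat.quad (Herm.toMat x) v := by
    obtain ⟨w, hw, hvw⟩ := hς.quad_eq v
    rw [hvw, ← hw, Mat.quad_one, Finset.mul_sum]
    exact Finset.sum_le_sum fun j _ => mul_le_mul_of_nonneg_right
      (hi ▸ ciInf_le (Set.finite_range ς).bddBelow j) (F.re_star_mul_self_nonneg _)
  have h2 := quad_ge (y - x) v
  have h3 : ‖y - x‖ < ς i := by rwa [← dist_eq_norm]
  change 0 < Mat.quad (Herm.toMat y) v
  have := mul_lt_mul_of_pos_right h3 (Mat.quad_one_pos hv)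
  rw [hsplit]
  linarith

/-- The exponential of Hermitian matrices. -/
def Herm.exp (y : Herm F N) : Herm F N := Herm.ofMat (NormedSpace.exp (Herm.toMat y))

namespace Herm

theorem toMat_exp (y : Herm F N) : toMat (exp y) = NormedSpace.exp (toMat y) :=
  toMat_ofMat_of_star_eq (by rw [NormedSpace.star_exp, star_toMat])

theorem _root_.IsEigenvalues.exp {s : Herm F N} {ς : Fin N → ℝ} (h : IsEigenvalues s ς) :
    IsEigenvalues (exp s) fun i => Real.exp (ς i) := by
  obtain ⟨k, h1, h2, h3⟩ := isEigenvalues_iff.1 h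
  exact isEigenvalues_iff.2 ⟨k, h1, h2, by rw [toMat_exp, h3, Mat.exp_conj h1 h2, Mat.exp_diag]⟩

theorem exp_mem (y : Herm F N) : exp y ∈ covMatrices F N := by
  obtain ⟨ς, hς⟩ := exists_isEigenvalues y
  exact (mem_covMatrices_iff_of_isEigenvalues hς.exp).2 fun i => Real.exp_pos _

theorem exists_exp_eq {x : Herm F N} (hx : x ∈ covMatrices F N) : ∃ y, exp y = x := by
  obtain ⟨ς, hς⟩ := exists_isEigenvalues x
  have hpos := (mem_covMatrices_iff_of_isEigenvalues hς).1 hx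
  obtain ⟨k, h1, h2, h3⟩ := isEigenvalues_iff.1 hς
  refine ⟨ofMat (k * Mat.diag (fun i => Real.log (ς i)) * star k), toMat_injective ?_⟩
  rw [toMat_exp, toMat_ofMat_of_star_eq (by simp [Mat.star_diag, mul_assoc]), Mat.exp_conj h1 h2,
    Mat.exp_diag, h3]
  simp only [Real.exp_log (hpos _)]

theorem range_exp : Set.range (exp : Herm F N → Herm F N) = covMatrices F N :=
  Set.Subset.antisymm (Set.range_subset_iff.2 exp_mem) fun _ hx => exists_exp_eq hx

/-- With diagonalizations by k and l, the matrix w = k†l intertwines diag(e^ς) with diag(e^τ). Thus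
(e^ς_i - e^τ_j) w_ij = 0, and injectivity of the real exponential shows that w also intertwines
diag(ς) with diag(τ). -/
theorem exp_injective : Function.Injective (exp : Herm F N → Herm F N) := by
  intro y z hyz
  obtain ⟨ς, hς⟩ := exists_isEigenvalues y
  obtain ⟨τ, hτ⟩ := exists_isEigenvalues z
  obtain ⟨k, h1, h2, h3⟩ := isEigenvalues_iff.1 hς
  obtain ⟨l, h4, h5, h6⟩ := isEigenvalues_iff.1 hτ
  obtain ⟨w, hw⟩ : ∃ w : Mat F N, w = star k * l := ⟨_, rfl⟩
  have hexp : Mat.diag (fun i => Real.exp (ς i)) * w = w * Mat.diag fun i => Real.exp (τ i) := by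
    have h := congrArg toMat hyz
    rw [toMat_exp, toMat_exp, h3, h6, Mat.exp_conj h1 h2, Mat.exp_conj h4 h5, Mat.exp_diag,
      Mat.exp_diag] at h
    have h' := congrArg (fun a => star k * a * l) h
    simp only [mul_assoc, h5, mul_one] at h'
    rw [← mul_assoc (star k) k, h2, one_mul] at h'
    rw [hw, h', mul_assoc]
  have hdiag : Mat.diag ς * w = w * Mat.diag τ := by
    refine Matrix.ext fun i j => ?_
    have h := (Mat.diag_mul_apply _ w i j).symm.trans
      ((congrFun (congrFun hexp i) j).trans (Mat.mul_diag_apply _ w i j))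
    refine (Mat.diag_mul_apply _ w i j).trans (Eq.trans ?_ (Mat.mul_diag_apply _ w i j).symm)
    rw [← sub_eq_zero, ← sub_smul, smul_eq_zero, sub_eq_zero] at h
    rcases h with h | h
    · rw [Real.exp_injective h]
    · rw [h, smul_zero, smul_zero]
  apply toMat_injective
  rw [h3, h6]
  have h7 := congrArg (fun a => k * a * star l) hdiag
  simp only [hw, mul_assoc, h4, mul_one] at h7
  rw [mul_assoc, h7, ← mul_assoc k (star k), h1, one_mul, mul_assoc]

theorem inverse_toMat_exp (y : Herm F N) :
    Ring.inverse (toMat (exp y)) = NormedSpace.exp (-toMat y) := by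
  rw [toMat_exp, Ring.inverse_exp]

theorem isUnit_toMat {x : Herm F N} (hx : x ∈ covMatrices F N) : IsUnit (toMat x) := by
  obtain ⟨y, rfl⟩ := exists_exp_eq hx
  rw [toMat_exp]
  exact NormedSpace.isUnit_exp _

theorem star_inverse_toMat {x : Herm F N} (hx : x ∈ covMatrices F N) :
    star (Ring.inverse (toMat x)) = Ring.inverse (toMat x) := by
  obtain ⟨y, rfl⟩ := exists_exp_eq hx
  rw [inverse_toMat_exp, NormedSpace.star_exp, star_neg, star_toMat]

end Herm

end

/-! ### Levi-Civita connection and curvature of the affine-invariant metric -/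

noncomputable section

variable {F : Scalars} {N : ℕ}

namespace Herm

/-- The inverse of the underlying matrix. -/
def inv (x : Herm F N) : Mat F N := Ring.inverse (toMat x)

theorem inv_exp (y : Herm F N) : inv (exp y) = NormedSpace.exp (-toMat y) := inverse_toMat_exp y

theorem inv_one : inv (1 : Herm F N) = 1 := by
  rw [inv, toMat_one, Ring.inverse_one]

theorem one_mem : (1 : Herm F N) ∈ covMatrices F N := by
  have h : exp (0 : Herm F N) = 1 :=
    toMat_injective (by rw [toMat_exp, map_zero, NormedSpace.exp_zero, toMat_one])
  exact h ▸ exp_mem 0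

theorem star_inv {x : Herm F N} (hx : x ∈ covMatrices F N) : star (inv x) = inv x :=
  star_inverse_toMat hx

theorem affineMetric_eq (x u v : Herm F N) : affineMetric F N x u v =
    Mat.tr (inv x * toMat u * inv x * toMat v) := rfl

/-- The congruence `u ↦ a u a†`. -/
def congruence (a : Mat F N) : Herm F N →L[ℝ] Herm F N :=
  ofMat ∘L (ContinuousLinearMap.mulLeftRight ℝ (Mat F N) a (star a)) ∘L toMat

theorem toMat_congruence (a : Mat F N) (u : Herm F N) :
    toMat (congruence a u) = a * toMat u * star a :=
  toMat_ofMat_of_star_eq (by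
    change star (a * toMat u * star a) = a * toMat u * star a
    simp [star_toMat, mul_assoc])

/-- The inverse of the square root of `exp y`. -/
def expHalf (y : Herm F N) : Mat F N := NormedSpace.exp (-((2⁻¹ : ℝ) • toMat y))

theorem star_expHalf (y : Herm F N) : star (expHalf y) = expHalf y := by
  rw [expHalf, NormedSpace.star_exp, star_neg, star_smul, star_toMat, star_trivial]

theorem isUnit_expHalf (y : Herm F N) : IsUnit (expHalf y) := NormedSpace.isUnit_exp _

theorem expHalf_mul_expHalf (y : Herm F N) : expHalf y * expHalf y = inv (exp y) := by
  rw [expHalf, ← NormedSpace.exp_add_of_commute (Commute.refl _), inv_exp, ← neg_add, ← two_smul ℝ,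
    smul_smul]
  norm_num

theorem toMat_congruence_expHalf (y u : Herm F N) :
    toMat (congruence (expHalf y) u) = expHalf y * toMat u * expHalf y := by
  rw [toMat_congruence, star_expHalf]

theorem congruence_expHalf_injective (y : Herm F N) :
    Function.Injective (congruence (expHalf y)) := by
  intro u v huv
  have h := congrArg toMat huv
  rw [toMat_congruence_expHalf, toMat_congruence_expHalf] at h
  exact toMat_injective ((isUnit_expHalf y).mul_left_cancel ((isUnit_expHalf y).mul_right_cancel h))

/-- Splitting x⁻¹ into two factors x^(-1/2) exhibits the congruence by x^(-1/2) as a linear isometry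
from the tangent space at x to that at the identity. This is the reduction on which everything at a
general point rests. -/
theorem affineMetric_exp (y u v : Herm F N) : affineMetric F N (exp y) u v =
    inner ℝ (congruence (expHalf y) u) (congruence (expHalf y) v) := by
  rw [affineMetric_eq, inner_eq_tr, toMat_congruence_expHalf, toMat_congruence_expHalf,
    ← expHalf_mul_expHalf]
  simp only [mul_assoc]
  rw [Mat.tr_mul_comm]
  simp only [mul_assoc]

/-- Nondegeneracy of the metric, which makes the vector selected by `Riem.christoffel` unique. -/
theorem eq_of_affineMetric_eq {x : Herm F N} (hx : x ∈ covMatrices F N) {z z' : Herm F N}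
    (h : ∀ w, affineMetric F N x z w = affineMetric F N x z' w) : z = z' := by
  obtain ⟨y, rfl⟩ := exists_exp_eq hx
  apply congruence_expHalf_injective y
  rw [← sub_eq_zero, ← inner_self_eq_zero (𝕜 := ℝ)]
  have := h (z - z')
  rw [affineMetric_exp, affineMetric_exp, ← sub_eq_zero, ← inner_sub_left, map_sub] at this
  exact this

theorem hasFDerivAt_inv {x : Herm F N} (hx : x ∈ covMatrices F N) :
    HasFDerivAt (inv : Herm F N → Mat F N)
      (-(ContinuousLinearMap.mulLeftRight ℝ (Mat F N) (inv x) (inv x)) ∘L toMat) x := by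
  obtain ⟨a, ha⟩ := isUnit_toMat hx
  have h := hasFDerivAt_ringInverse (𝕜 := ℝ) a
  have h1 : (↑a⁻¹ : Mat F N) = inv x := by rw [inv, ← ha, Ring.inverse_unit]
  rw [h1, ha] at h
  exact h.comp x (toMat (F := F) (N := N)).hasFDerivAt

theorem fderiv_affineMetric {x : Herm F N} (hx : x ∈ covMatrices F N) (u v w : Herm F N) :
    fderiv ℝ (fun y => affineMetric F N y v w) x u =
      -Mat.tr (inv x * toMat u * inv x * toMat v * inv x * toMat w) -
        Mat.tr (inv x * toMat v * inv x * toMat u * inv x * toMat w) := by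
  have h := hasFDerivAt_inv hx
  have h1 := (((h.mul_const' (toMat v)).mul' h).mul_const' (toMat w))
  have h2 := (Mat.tr (F := F) (N := N)).hasFDerivAt.comp x h1
  have h3 : HasFDerivAt (fun y => affineMetric F N y v w) _ x := h2
  rw [h3.fderiv]
  change Mat.tr ((inv x * toMat v * -(inv x * toMat u * inv x) +
    -(inv x * toMat u * inv x) * toMat v * inv x) * toMat w) = _
  simp only [mul_neg, neg_mul, add_mul, map_add, map_neg, mul_assoc]
  ring

theorem affineMetric_ofMat (x : Herm F N) (a : Mat F N) (w : Herm F N) :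
    affineMetric F N x (ofMat a) w = (2⁻¹ : ℝ) *
      (Mat.tr (inv x * a * inv x * toMat w) + Mat.tr (inv x * star a * inv x * toMat w)) := by
  rw [affineMetric_eq, toMat_ofMat]
  simp only [mul_smul_comm, smul_mul_assoc, mul_add, add_mul, map_smul, map_add, smul_eq_mul]

theorem affineMetric_christoffel {x : Herm F N} (hx : x ∈ covMatrices F N) (u v w : Herm F N) :
    affineMetric F N x (-ofMat (toMat u * inv x * toMat v)) w =
      Riem.koszul (affineMetric F N) x u v w := by
  -- Up to cyclic rotation only two traces occur in the Koszul expression, those of the words uvw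
  -- and vuw, each alternating with x⁻¹.
  have hcyc (a b c : Mat F N) : Mat.tr (inv x * a * inv x * b * inv x * c) =
      Mat.tr (inv x * c * inv x * a * inv x * b) := by
    rw [mul_assoc, Mat.tr_mul_comm]
    simp only [mul_assoc]
  rw [Riem.koszul, fderiv_affineMetric hx, fderiv_affineMetric hx, fderiv_affineMetric hx,
    hcyc (toMat w) (toMat u) (toMat v), hcyc (toMat v) (toMat w) (toMat u),
    hcyc (toMat u) (toMat w) (toMat v), hcyc (toMat v) (toMat u) (toMat w), ← map_neg,
    affineMetric_ofMat]
  simp only [star_neg, star_mul, star_toMat, star_inv hx, mul_neg, neg_mul, map_neg, ← mul_assoc]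
  rw [hcyc (toMat u) (toMat v) (toMat w), hcyc (toMat v) (toMat u) (toMat w)]
  ring

theorem christoffel_eq {x : Herm F N} (hx : x ∈ covMatrices F N) (u v : Herm F N) :
    Riem.christoffel (affineMetric F N) x u v = -ofMat (toMat u * inv x * toMat v) := by
  have h := Classical.epsilon_spec (p := fun z => ∀ w, affineMetric F N x z w =
    Riem.koszul (affineMetric F N) x u v w) ⟨_, affineMetric_christoffel hx u v⟩
  exact eq_of_affineMetric_eq hx fun w => (h w).trans (affineMetric_christoffel hx u v w).symm

theorem toMat_christoffel {x : Herm F N} (hx : x ∈ covMatrices F N) (u v : Herm F N) :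
    toMat (Riem.christoffel (affineMetric F N) x u v) =
      -((2⁻¹ : ℝ) • (toMat u * inv x * toMat v + toMat v * inv x * toMat u)) := by
  rw [christoffel_eq hx, map_neg, toMat_ofMat]
  simp [star_toMat, star_inv hx, mul_assoc]

theorem fderiv_christoffel {x : Herm F N} (hx : x ∈ covMatrices F N) (u v w : Herm F N) :
    fderiv ℝ (fun y => Riem.christoffel (affineMetric F N) y v w) x u =
      ofMat (toMat v * inv x * toMat u * inv x * toMat w) := by
  -- The closed form of the Christoffel map is valid only on `M`. As `M` is open, the two functions
  -- agree near x, which suffices for the derivative.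
  have h : (fun y => Riem.christoffel (affineMetric F N) y v w) =ᶠ[nhds x]
      fun y => -ofMat (toMat v * inv y * toMat w) := by
    filter_upwards [isOpen_covMatrices.mem_nhds hx] with y hy
    exact christoffel_eq hy v w
  have h1 := (((hasFDerivAt_inv hx).const_mul (toMat v)).mul_const' (toMat w))
  have h2 := ((ofMat (F := F) (N := N)).hasFDerivAt.comp x h1).neg
  have h3 : HasFDerivAt (fun y => -ofMat (toMat v * inv y * toMat w)) _ x := h2
  rw [h.fderiv_eq, h3.fderiv]
  change -ofMat (toMat v * -(inv x * toMat u * inv x) * toMat w) = _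
  simp only [mul_neg, neg_mul, map_neg, neg_neg, mul_assoc]

/-- At x = 1 the right-hand side is -¼[[u,v],w], the curvature of a symmetric space. -/
theorem toMat_curvature {x : Herm F N} (hx : x ∈ covMatrices F N) (u v w : Herm F N) :
    toMat (Riem.curvature (affineMetric F N) x u v w) = (4⁻¹ : ℝ) •
      (toMat v * inv x * toMat u * inv x * toMat w + toMat w * inv x * toMat u * inv x * toMat v
        - toMat u * inv x * toMat v * inv x * toMat w
        - toMat w * inv x * toMat v * inv x * toMat u) := by
  rw [Riem.curvature, fderiv_christoffel hx, fderiv_christoffel hx, map_sub, map_add, map_sub,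
    toMat_christoffel hx u, toMat_christoffel hx v w, toMat_christoffel hx v,
    toMat_christoffel hx u w,
    toMat_ofMat, toMat_ofMat]
  simp only [star_mul, star_toMat, star_inv hx, mul_neg, neg_mul, mul_add, add_mul, mul_smul_comm,
    smul_mul_assoc, mul_assoc]
  module

/-- The curvature at x is built from words in the arguments and x⁻¹. Replacing x⁻¹ by x^(-1/2)
x^(-1/2) and distributing the two halves turns each word into the one at the identity. -/
theorem congruence_curvature (y u v w : Herm F N) :
    congruence (expHalf y) (Riem.curvature (affineMetric F N) (exp y) u v w) =
      Riem.curvature (affineMetric F N) 1 (congruence (expHalf y) u) (congruence (expHalf y) v)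
        (congruence (expHalf y) w) := by
  apply toMat_injective
  rw [toMat_congruence_expHalf, toMat_curvature (exp_mem y), toMat_curvature one_mem, inv_one,
    toMat_congruence_expHalf, toMat_congruence_expHalf, toMat_congruence_expHalf,
    ← expHalf_mul_expHalf]
  simp only [mul_smul_comm, smul_mul_assoc, mul_add, add_mul, mul_sub, sub_mul, mul_one, mul_assoc]

theorem sectional_exp (y u v : Herm F N) : Riem.sectional (affineMetric F N) (exp y) u v =
    Riem.sectional (affineMetric F N) 1 (congruence (expHalf y) u) (congruence (expHalf y) v) := by
  simp only [Riem.sectional, affineMetric_exp, affineMetric_one, congruence_curvature]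

end Herm

end

/-! ### Geodesics, the Riemannian exponential map and parallel transport -/

noncomputable section

variable {F : Scalars} {N : ℕ}

namespace Herm

theorem hasDerivAt_toMat {γ : ℝ → Herm F N} {γ' : Herm F N} {t : ℝ} (h : HasDerivAt γ γ' t) :
    HasDerivAt (fun t => toMat (γ t)) (toMat γ') t :=
  (toMat (F := F) (N := N)).hasFDerivAt.comp_hasDerivAt t h

theorem hasDerivAt_of_toMat {γ : ℝ → Herm F N} {γ' : Herm F N} {t : ℝ}
    (h : HasDerivAt (fun t => toMat (γ t)) (toMat γ') t) : HasDerivAt γ γ' t := by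
  have h1 := (ofMat (F := F) (N := N)).hasFDerivAt.comp_hasDerivAt t h
  have h2 : (fun t => ofMat (toMat (γ t))) = γ := funext fun t => ofMat_toMat _
  exact h2 ▸ h1.congr_deriv (ofMat_toMat γ')

theorem toMat_mul_inv {x : Herm F N} (hx : x ∈ covMatrices F N) : toMat x * inv x = 1 :=
  Ring.mul_inverse_cancel _ (isUnit_toMat hx)

theorem hasDerivAt_inv {γ : ℝ → Herm F N} {γ' : Herm F N} {t : ℝ} (h : HasDerivAt γ γ' t)
    (hγ : γ t ∈ covMatrices F N) :
    HasDerivAt (fun t => inv (γ t)) (-(inv (γ t) * toMat γ' * inv (γ t))) t :=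
  (hasFDerivAt_inv hγ).comp_hasDerivAt t h

theorem commute_exp_smul (a : Mat F N) (t : ℝ) : Commute a (NormedSpace.exp (t • a)) :=
  ((Commute.refl a).smul_right t).exp_right

theorem eq_of_forall_hasDerivAt_zero {f : ℝ → Mat F N} (h : ∀ t, HasDerivAt f 0 t) (t : ℝ) :
    f t = f 0 :=
  is_const_of_deriv_eq_zero (fun t => (h t).differentiableAt) (fun t => (h t).deriv) t 0

/-- The geodesic equation γ'' = γ'γ⁻¹γ' has the first integral γ⁻¹γ'. This leaves the linear
equation γ' = γs, for which γ e^(-ts) is constant. -/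
theorem eq_exp_of_isGeodesic {γ : ℝ → Herm F N} {s : Herm F N}
    (hγ : Riem.IsGeodesic (affineMetric F N) (covMatrices F N) γ) (h0 : γ 0 = 1)
    (h1 : deriv γ 0 = s) : γ = fun t => exp (t • s) := by
  have hd (t : ℝ) : HasDerivAt γ (deriv γ t) t :=
    (hγ.contDiff.differentiable (by norm_num) t).hasDerivAt
  have hdd (t : ℝ) : HasDerivAt (deriv γ) (deriv (deriv γ) t) t :=
    (((contDiff_succ_iff_deriv (n := 1)).1 hγ.contDiff).2.2.differentiable (by norm_num) t).hasDerivAt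
  have hacc (t : ℝ) : toMat (deriv (deriv γ) t) =
      toMat (deriv γ t) * inv (γ t) * toMat (deriv γ t) := by
    have h := congrArg toMat (eq_neg_of_add_eq_zero_left (hγ.eq_zero t))
    rw [map_neg, toMat_christoffel (hγ.mem t), neg_neg, ← two_smul ℝ, smul_smul] at h
    simpa using h
  have hvel (t : ℝ) : toMat (deriv γ t) = toMat (γ t) * toMat s := by
    have hp := eq_of_forall_hasDerivAt_zero (f := fun t => inv (γ t) * toMat (deriv γ t))
      (fun t => by
        have h := (hasDerivAt_inv (hd t) (hγ.mem t)).mul (hasDerivAt_toMat (hdd t))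
        rw [hacc] at h
        refine h.congr_deriv ?_
        simp only [neg_mul, mul_assoc, neg_add_cancel]) t
    rw [h0, h1, inv_one, one_mul] at hp
    rw [← hp, ← mul_assoc, toMat_mul_inv (hγ.mem t), one_mul]
  funext t
  apply toMat_injective
  have hq := eq_of_forall_hasDerivAt_zero
    (f := fun t => toMat (γ t) * NormedSpace.exp (t • -toMat s)) (fun t => by
      have h := (hasDerivAt_toMat (hd t)).mul (Mat.hasDerivAt_exp_smul (-toMat s) t)
      rw [hvel, ← (commute_exp_smul (-toMat s) t).eq] at h
      refine h.congr_deriv ?_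
      simp only [neg_mul, mul_neg, mul_assoc, add_neg_cancel]) t
  simp only [h0, toMat_one, zero_smul, smul_neg, neg_zero, NormedSpace.exp_zero, mul_one] at hq
  rw [toMat_exp, map_smul]
  have h2 := congrArg (fun a => a * NormedSpace.exp (t • toMat s)) hq
  simpa only [mul_assoc, Mat.exp_neg_mul_exp, mul_one, one_mul] using h2

/-- The velocity of `t ↦ exp (t s)`. -/
def expVelocity (s : Herm F N) (t : ℝ) : Herm F N := ofMat (toMat (exp (t • s)) * toMat s)

theorem toMat_exp_smul (s : Herm F N) (t : ℝ) :
    toMat (exp (t • s)) = NormedSpace.exp (t • toMat s) := by rw [toMat_exp, map_smul]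

theorem toMat_expVelocity (s : Herm F N) (t : ℝ) :
    toMat (expVelocity s t) = NormedSpace.exp (t • toMat s) * toMat s := by
  rw [expVelocity, toMat_exp_smul]
  refine toMat_ofMat_of_star_eq ?_
  rw [star_mul, star_toMat, NormedSpace.star_exp, star_smul, star_toMat, star_trivial,
    (commute_exp_smul (toMat s) t).eq]

theorem hasDerivAt_exp_smul (s : Herm F N) (t : ℝ) :
    HasDerivAt (fun t : ℝ => exp (t • s)) (expVelocity s t) t := by
  apply hasDerivAt_of_toMat
  simp only [toMat_exp_smul, toMat_expVelocity]
  exact Mat.hasDerivAt_exp_smul _ _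

theorem deriv_exp_smul (s : Herm F N) : deriv (fun t : ℝ => exp (t • s)) = expVelocity s :=
  funext fun t => (hasDerivAt_exp_smul s t).deriv

theorem inv_exp_smul (s : Herm F N) (t : ℝ) :
    inv (exp (t • s)) = NormedSpace.exp (-(t • toMat s)) := by rw [inv_exp, map_smul]

theorem toMat_expVelocity_mul_inv (s : Herm F N) (t : ℝ) :
    toMat (expVelocity s t) * inv (exp (t • s)) = toMat s := by
  rw [toMat_expVelocity, inv_exp_smul, ← (commute_exp_smul (toMat s) t).eq, mul_assoc,
    Mat.exp_mul_exp_neg, mul_one]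

theorem inv_mul_toMat_expVelocity (s : Herm F N) (t : ℝ) :
    inv (exp (t • s)) * toMat (expVelocity s t) = toMat s := by
  rw [toMat_expVelocity, inv_exp_smul, ← mul_assoc, Mat.exp_neg_mul_exp, one_mul]

theorem contDiff_exp : ContDiff ℝ ⊤ (exp : Herm F N → Herm F N) := by
  refine (ofMat (F := F) (N := N)).contDiff.comp (ContDiff.comp ?_ (toMat (F := F) (N := N)).contDiff)
  exact contDiff_iff_contDiffAt.2 fun a => (NormedSpace.exp_analytic (𝕂 := ℝ) a).contDiffAt

theorem isGeodesic_exp (s : Herm F N) :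
    Riem.IsGeodesic (affineMetric F N) (covMatrices F N) fun t => exp (t • s) where
  mem t := exp_mem _
  contDiff := (contDiff_exp.of_le le_top).comp (contDiff_id.smul contDiff_const)
  eq_zero t := by
    have h : HasDerivAt (expVelocity s)
        (ofMat (NormedSpace.exp (t • toMat s) * toMat s * toMat s)) t := by
      have h1 := (ofMat (F := F) (N := N)).hasFDerivAt.comp_hasDerivAt t
        ((Mat.hasDerivAt_exp_smul (toMat s) t).mul_const (toMat s))
      refine h1.congr_of_eventuallyEq (Filter.Eventually.of_forall fun r => ?_)
      rw [expVelocity, toMat_exp_smul]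
      rfl
    rw [deriv_exp_smul, h.deriv, christoffel_eq (exp_mem _), toMat_expVelocity_mul_inv,
      toMat_expVelocity, ← sub_eq_add_neg, sub_eq_zero, ← mul_assoc,
      (commute_exp_smul (toMat s) t).eq]

theorem expVelocity_zero (s : Herm F N) : expVelocity s 0 = s := by
  apply toMat_injective
  rw [toMat_expVelocity, zero_smul, NormedSpace.exp_zero, one_mul]

theorem exp_zero : exp (0 : Herm F N) = 1 :=
  toMat_injective (by rw [toMat_exp, map_zero, NormedSpace.exp_zero, toMat_one])

/-- Since `Riem.riemExp` is a choice, both existence and uniqueness of the geodesic enter. -/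
theorem riemExp_one (s : Herm F N) :
    Riem.riemExp (affineMetric F N) (covMatrices F N) 1 s = exp s := by
  have h := Classical.epsilon_spec (p := fun y => ∃ γ : ℝ → Herm F N,
    Riem.IsGeodesic (affineMetric F N) (covMatrices F N) γ ∧ γ 0 = 1 ∧ deriv γ 0 = s ∧ γ 1 = y)
    ⟨_, _, isGeodesic_exp s, by rw [zero_smul, exp_zero], by rw [deriv_exp_smul, expVelocity_zero],
      rfl⟩
  obtain ⟨γ, h1, h2, h3, h4⟩ := h
  rw [Riem.riemExp, ← h4, eq_exp_of_isGeodesic h1 h2 h3]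
  simp only [one_smul]

theorem hasDerivAt_expHalf_smul (s : Herm F N) (t : ℝ) :
    HasDerivAt (fun t : ℝ => expHalf (t • s)) (expHalf (t • s) * -((2⁻¹ : ℝ) • toMat s)) t := by
  have h (t : ℝ) : expHalf (t • s) = NormedSpace.exp (t • -((2⁻¹ : ℝ) • toMat s)) := by
    rw [expHalf, map_smul, smul_comm, smul_neg]
  simp only [h]
  exact Mat.hasDerivAt_exp_smul _ _

theorem commute_expHalf_smul (s : Herm F N) (t : ℝ) : Commute (toMat s) (expHalf (t • s)) := by
  rw [expHalf, map_smul]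
  exact (((Commute.refl _).smul_right t).smul_right _).neg_right.exp_right

/-- The parallel equation along exp(ts) is V' = ½(sγ⁻¹-free form) with left and right multiplication
by s, namely V' = ½(sV + Vs). Hence e^(-ts/2) V e^(-ts/2) has zero derivative. -/
theorem congruence_expHalf_of_isParallel {s : Herm F N} {V : ℝ → Herm F N}
    (hV : Riem.IsParallel (affineMetric F N) (fun t => exp (t • s)) V) (t : ℝ) :
    congruence (expHalf (t • s)) (V t) = V 0 := by
  apply toMat_injective
  have hd (t : ℝ) : HasDerivAt V (deriv V t) t := (hV.differentiable t).hasDerivAt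
  have heq (t : ℝ) : toMat (deriv V t) = (2⁻¹ : ℝ) • (toMat s * toMat (V t) + toMat (V t) * toMat s) := by
    have h := congrArg toMat (eq_neg_of_add_eq_zero_left (hV.eq_zero t))
    rwa [map_neg, toMat_christoffel (exp_mem _), neg_neg, deriv_exp_smul,
      toMat_expVelocity_mul_inv, mul_assoc (toMat (V t)), inv_mul_toMat_expVelocity] at h
  have hc := eq_of_forall_hasDerivAt_zero
    (f := fun t => expHalf (t • s) * toMat (V t) * expHalf (t • s)) (fun t => by
      have h := ((hasDerivAt_expHalf_smul s t).mul (hasDerivAt_toMat (hd t))).mul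
        (hasDerivAt_expHalf_smul s t)
      refine h.congr_deriv ?_
      have hcomm := (commute_expHalf_smul s t).eq
      simp only [heq, Pi.mul_apply, mul_neg, neg_mul, mul_smul_comm, smul_mul_assoc, mul_add, add_mul, mul_assoc,
        hcomm]
      module) t
  simp only [zero_smul] at hc
  rw [toMat_congruence_expHalf, hc, expHalf, map_zero, smul_zero, neg_zero, NormedSpace.exp_zero,
    one_mul, mul_one]

end Herm

end

/-! ### Orthonormal eigenbases of the radial curvature operator -/

noncomputable section

variable {F : Scalars} {N : ℕ}

namespace Mat

/-- The matrix whose only non-zero entry is `q`, at `(i, j)`. -/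
def single (i j : Fin N) (q : F.K) : Mat F N := Matrix.single i j q

theorem single_apply (i j i' j' : Fin N) (q : F.K) :
    (single i j q : Mat F N) i' j' = if i = i' ∧ j = j' then q else 0 :=
  Matrix.single_apply (α := F.K) i j q i' j'

theorem diag_mul_single (ς : Fin N → ℝ) (i j : Fin N) (q : F.K) :
    diag ς * (single i j q : Mat F N) = ς i • single i j q := by
  refine Matrix.ext fun i' j' => (diag_mul_apply _ _ i' j').trans ?_
  change _ = ς i • (single i j q : Mat F N) i' j'
  rw [single_apply]
  split_ifs with h
  · rw [h.1]
  · rw [smul_zero, smul_zero]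

theorem single_mul_diag (ς : Fin N → ℝ) (i j : Fin N) (q : F.K) :
    (single i j q : Mat F N) * diag ς = ς j • single i j q := by
  refine Matrix.ext fun i' j' => (mul_diag_apply _ _ i' j').trans ?_
  change _ = ς j • (single i j q : Mat F N) i' j'
  rw [single_apply]
  split_ifs with h
  · rw [h.2]
  · rw [smul_zero, smul_zero]

theorem tr_mul_eq_sum (a b : Mat F N) : tr (a * b) = ∑ i, ∑ j, F.re (a i j * b j i) := by
  have h (c d : Matrix (Fin N) (Fin N) F.K) :
      F.re (Matrix.trace (c * d)) = ∑ i, ∑ j, F.re (c i j * d j i) := by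
    simp only [Matrix.trace, Matrix.diag, Matrix.mul_apply, map_sum]
  exact h a b

theorem tr_single_mul (i j : Fin N) (q : F.K) (a : Mat F N) :
    tr (single i j q * a) = F.re (q * a j i) := by
  rw [tr_mul_eq_sum, Finset.sum_eq_single i, Finset.sum_eq_single j]
  · rw [single_apply, if_pos ⟨rfl, rfl⟩]
  · intro l _ hl
    rw [single_apply, if_neg fun h => hl h.2.symm, zero_mul, map_zero]
  · simp
  · intro l _ hl
    refine Finset.sum_eq_zero fun m _ => ?_
    rw [single_apply, if_neg fun h => hl h.1.symm, zero_mul, map_zero]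
  · simp

theorem tr_diag_mul (ς : Fin N → ℝ) (a : Mat F N) :
    tr (diag ς * a) = ∑ i, ς i * F.re (a i i) := by
  have h (c : Matrix (Fin N) (Fin N) F.K) :
      F.re (Matrix.trace c) = ∑ i, F.re (c i i) := by
    simp only [Matrix.trace, Matrix.diag, map_sum]
  refine (h (diag ς * a : Mat F N)).trans (Finset.sum_congr rfl fun i _ => ?_)
  refine (congrArg F.re (diag_mul_apply ς a i i)).trans ?_
  rw [map_smul, smul_eq_mul]

theorem diag_apply_self (ς : Fin N → ℝ) (i : Fin N) :
    (diag ς : Mat F N) i i = algebraMap ℝ F.K (ς i) := Matrix.diagonal_apply_eq (α := F.K) _ i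

theorem diag_apply_ne (ς : Fin N → ℝ) {i j : Fin N} (h : i ≠ j) :
    (diag ς : Mat F N) i j = 0 := Matrix.diagonal_apply_ne (α := F.K) _ h

end Mat

namespace Herm

/-- A Hermitian matrix pairs with a and with a† in the same way, so the left argument of a scalar
product need not be symmetrized. -/
theorem inner_ofMat (a : Mat F N) (h : Herm F N) : inner ℝ (ofMat a) h = Mat.tr (a * toMat h) := by
  rw [inner_eq_tr, toMat_ofMat, smul_mul_assoc, map_smul, add_mul, map_add]
  have h1 : Mat.tr (star a * toMat h) = Mat.tr (a * toMat h) := by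
    rw [← Mat.tr_star, star_mul, star_star, star_toMat, Mat.tr_mul_comm]
  rw [h1, smul_eq_mul]
  ring

/-- The orthonormal basis of the diagonal and off-diagonal Hermitian matrices, before conjugation
with a unitary matrix and symmetrization. -/
def adaptedMat (w : OrthonormalBasis (Fin N) ℝ (EuclideanSpace ℝ (Fin N))) :
    Fin N ⊕ ({p : Fin N × Fin N // p.1 < p.2} × Fin F.β) → Mat F N :=
  Sum.elim (fun a => Mat.diag (w a)) fun q => √2 • Mat.single q.1.1.1 q.1.1.2 (F.unit q.2)

theorem tr_adaptedMat_inl_mul (w : OrthonormalBasis (Fin N) ℝ (EuclideanSpace ℝ (Fin N)))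
    (a : Fin N) (h : Mat F N) :
    Mat.tr (adaptedMat w (Sum.inl a) * h) = inner ℝ (w a) (WithLp.toLp 2 fun i => F.re (h i i)) := by
  rw [adaptedMat, Sum.elim_inl, Mat.tr_diag_mul, PiLp.inner_apply]
  simp [mul_comm]

theorem tr_adaptedMat_inr_mul (w : OrthonormalBasis (Fin N) ℝ (EuclideanSpace ℝ (Fin N)))
    (q : {p : Fin N × Fin N // p.1 < p.2} × Fin F.β) (h : Herm F N) :
    Mat.tr (adaptedMat w (Sum.inr q) * toMat h) =
      √2 * F.re (star (F.unit q.2) * toMat h q.1.1.1 q.1.1.2) := by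
  rw [adaptedMat, Sum.elim_inr, smul_mul_assoc, map_smul, smul_eq_mul, Mat.tr_single_mul,
    ← F.re_star, star_mul, ← Mat.star_apply, star_toMat, F.re_mul_comm]

theorem toMat_ofMat_apply (a : Mat F N) (i j : Fin N) :
    toMat (ofMat a) i j = (2⁻¹ : ℝ) • (a i j + star (a j i)) := rfl

theorem adaptedMat_inl_apply_self (w : OrthonormalBasis (Fin N) ℝ (EuclideanSpace ℝ (Fin N)))
    (a i : Fin N) :
    F.re (toMat (ofMat (adaptedMat w (Sum.inl a) : Mat F N)) i i) = w a i := by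
  rw [toMat_ofMat_apply, adaptedMat, Sum.elim_inl, Mat.diag_apply_self, F.star_algebraMap, map_smul,
    map_add, F.re_algebraMap, smul_eq_mul]
  ring

theorem adaptedMat_inl_apply_of_lt (w : OrthonormalBasis (Fin N) ℝ (EuclideanSpace ℝ (Fin N)))
    (a : Fin N) {i j : Fin N} (h : i < j) :
    toMat (ofMat (adaptedMat w (Sum.inl a) : Mat F N)) i j = 0 := by
  rw [toMat_ofMat_apply, adaptedMat, Sum.elim_inl, Mat.diag_apply_ne _ h.ne,
    Mat.diag_apply_ne _ h.ne', star_zero, add_zero, smul_zero]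

theorem adaptedMat_inr_apply_self (w : OrthonormalBasis (Fin N) ℝ (EuclideanSpace ℝ (Fin N)))
    (q : {p : Fin N × Fin N // p.1 < p.2} × Fin F.β) (i : Fin N) :
    toMat (ofMat (adaptedMat w (Sum.inr q) : Mat F N)) i i = 0 := by
  have h : (adaptedMat w (Sum.inr q) : Mat F N) i i = 0 := by
    change √2 • (Mat.single q.1.1.1 q.1.1.2 (F.unit q.2) : Mat F N) i i = 0
    rw [Mat.single_apply, if_neg, smul_zero]
    exact fun h => q.1.2.ne (h.1.trans h.2.symm)
  rw [toMat_ofMat_apply, h, star_zero, add_zero, smul_zero]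

theorem adaptedMat_inr_apply_of_lt (w : OrthonormalBasis (Fin N) ℝ (EuclideanSpace ℝ (Fin N)))
    (q : {p : Fin N × Fin N // p.1 < p.2} × Fin F.β) (p : {p : Fin N × Fin N // p.1 < p.2}) :
    toMat (ofMat (adaptedMat w (Sum.inr q) : Mat F N)) p.1.1 p.1.2 =
      (√2 / 2) • if q.1 = p then F.unit q.2 else 0 := by
  have h1 : (adaptedMat w (Sum.inr q) : Mat F N) p.1.1 p.1.2 =
      √2 • if q.1 = p then F.unit q.2 else 0 := by
    change √2 • (Mat.single q.1.1.1 q.1.1.2 (F.unit q.2) : Mat F N) p.1.1 p.1.2 = _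
    rw [Mat.single_apply]
    congr 2
    rw [Subtype.ext_iff, Prod.ext_iff]
  have h2 : (adaptedMat w (Sum.inr q) : Mat F N) p.1.2 p.1.1 = 0 := by
    change √2 • (Mat.single q.1.1.1 q.1.1.2 (F.unit q.2) : Mat F N) p.1.2 p.1.1 = 0
    rw [Mat.single_apply, if_neg, smul_zero]
    rintro ⟨h, h'⟩
    have := q.1.2
    rw [h, h'] at this
    exact lt_asymm this p.2
  rw [toMat_ofMat_apply, h1, h2, star_zero, add_zero, smul_smul]
  congr 1
  ring

/-- By `inner_ofMat` this is the Gram matrix of the Hermitian parts. The factor √2 normalizes the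
off-diagonal ones: the Hermitian part of √2 q E_ij is (q E_ij + q† E_ji)/√2, of norm 1 for a unit q.
-/
theorem tr_adaptedMat (w : OrthonormalBasis (Fin N) ℝ (EuclideanSpace ℝ (Fin N)))
    (a b : Fin N ⊕ ({p : Fin N × Fin N // p.1 < p.2} × Fin F.β)) :
    Mat.tr (adaptedMat w a * toMat (ofMat (adaptedMat w b))) = if a = b then 1 else 0 := by
  rcases a with a | q <;> rcases b with b | p
  · rw [tr_adaptedMat_inl_mul]
    simp only [adaptedMat_inl_apply_self, Sum.inl.injEq]
    exact (orthonormal_iff_ite.1 w.orthonormal) a b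
  · rw [tr_adaptedMat_inl_mul]
    simp only [adaptedMat_inr_apply_self, map_zero]
    rw [if_neg (by simp)]
    exact inner_zero_right _
  · rw [tr_adaptedMat_inr_mul, adaptedMat_inl_apply_of_lt _ _ q.1.2, mul_zero, map_zero, mul_zero,
      if_neg (by simp)]
  · rw [tr_adaptedMat_inr_mul, adaptedMat_inr_apply_of_lt, mul_smul_comm, map_smul, smul_eq_mul,
      ← mul_assoc, ← mul_div_assoc, Real.mul_self_sqrt zero_le_two, div_self two_ne_zero, one_mul]
    obtain ⟨q1, q2⟩ := q
    obtain ⟨p1, p2⟩ := p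
    simp only [Sum.inr.injEq, Prod.mk.injEq]
    by_cases h : p1 = q1
    · subst h
      simp only [if_true, F.re_star_unit_mul_unit, true_and]
    · rw [if_neg h, if_neg fun h' => h h'.1.symm, mul_zero, map_zero]

theorem eq_zero_of_tr_adaptedMat (w : OrthonormalBasis (Fin N) ℝ (EuclideanSpace ℝ (Fin N)))
    {h : Herm F N} (h0 : ∀ a, Mat.tr (adaptedMat w a * toMat h) = 0) : h = 0 := by
  have hlt (i j : Fin N) (hij : i < j) : toMat h i j = 0 := by
    refine F.eq_zero_of_re_star_unit_mul fun m => ?_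
    have := h0 (Sum.inr (⟨(i, j), hij⟩, m))
    rw [tr_adaptedMat_inr_mul] at this
    exact (mul_eq_zero.1 this).resolve_left (by positivity)
  have hstar (i j : Fin N) : star (toMat h j i) = toMat h i j := by
    rw [← Mat.star_apply, star_toMat]
  have hdiag : (WithLp.toLp 2 fun i => F.re (toMat h i i) : EuclideanSpace ℝ (Fin N)) = 0 := by
    refine w.repr.injective ?_
    ext a
    rw [w.repr_apply_apply, ← tr_adaptedMat_inl_mul, h0, map_zero]
    rfl
  apply toMat_injective
  refine Matrix.ext fun i j => ?_
  change toMat h i j = 0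
  rcases lt_trichotomy i j with hij | rfl | hij
  · exact hlt i j hij
  · rw [F.eq_algebraMap_of_star_eq (hstar i i)]
    have : F.re (toMat h i i) = 0 := congrFun (congrArg WithLp.ofLp hdiag) i
    rw [this, map_zero]
  · rw [← hstar, hlt j i hij, star_zero]

/-- Conjugation of the adapted basis with the unitary matrix `k`. -/
theorem exists_orthonormalBasis {k : Mat F N} (h1 : k * star k = 1) (h2 : star k * k = 1)
    (w : OrthonormalBasis (Fin N) ℝ (EuclideanSpace ℝ (Fin N))) :
    ∃ u : OrthonormalBasis (Fin N ⊕ ({p : Fin N × Fin N // p.1 < p.2} × Fin F.β)) ℝ (Herm F N),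
      ∀ a, u a = ofMat (k * adaptedMat w a * star k) := by
  have htr (a : Mat F N) (h : Herm F N) : inner ℝ (ofMat (k * a * star k)) h =
      Mat.tr (a * toMat (congruence (star k) h)) := by
    rw [inner_ofMat, toMat_congruence, star_star, mul_assoc, mul_assoc, Mat.tr_mul_comm]
    simp only [mul_assoc]
  have hcongr (a : Mat F N) : congruence (star k) (ofMat (k * a * star k)) = ofMat a := by
    apply toMat_injective
    rw [toMat_congruence, toMat_ofMat, toMat_ofMat, star_star, mul_smul_comm, smul_mul_assoc]
    congr 1
    have h (b : Mat F N) : star k * (k * b * star k) * k = b := by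
      simp only [mul_assoc, h2, mul_one]
      rw [← mul_assoc, h2, one_mul]
    have h' : star (k * a * star k) = k * star a * star k := by simp [mul_assoc]
    rw [h', mul_add, add_mul, h, h]
  have hon : Orthonormal ℝ fun a => ofMat (k * (adaptedMat w a : Mat F N) * star k) := by
    rw [orthonormal_iff_ite]
    intro a b
    rw [htr, hcongr, tr_adaptedMat]
  -- Completeness is proved by showing that the orthogonal complement of the family is trivial, with
  -- no dimension count.
  refine ⟨OrthonormalBasis.mkOfOrthogonalEqBot hon ?_, fun a =>
    congrFun (OrthonormalBasis.coe_of_orthogonal_eq_bot_mk hon _) a⟩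
  rw [Submodule.eq_bot_iff]
  intro h hh
  have h0 : congruence (star k) h = 0 := by
    refine eq_zero_of_tr_adaptedMat w fun a => ?_
    rw [← htr]
    exact (Submodule.mem_orthogonal _ _).1 hh _ (Submodule.subset_span ⟨a, rfl⟩)
  have h3 := congrArg (fun a => k * toMat a * star k) h0
  simp only [toMat_congruence, star_star, map_zero, mul_zero, zero_mul, mul_assoc, h1, mul_one] at h3
  rw [← mul_assoc, h1, one_mul] at h3
  exact toMat_injective (h3.trans (map_zero _).symm)

/-- An orthonormal basis of Hermitian matrices adapted to a unit vector `s`. -/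
theorem exists_adapted_orthonormalBasis {s : Herm F N} {ς : Fin N → ℝ} (hN : 1 ≤ N) (hs : ‖s‖ = 1)
    (h : IsEigenvalues s ς) :
    ∃ u : OrthonormalBasis (Fin N ⊕ ({p : Fin N × Fin N // p.1 < p.2} × Fin F.β)) ℝ (Herm F N),
      u (Sum.inl ⟨0, hN⟩) = s ∧ (∀ a, Commute (toMat s) (toMat (u (Sum.inl a)))) ∧
      ∀ q, ∃ P : Mat F N, toMat s * P = ς q.1.1.1 • P ∧ P * toMat s = ς q.1.1.2 • P ∧
        toMat (u (Sum.inr q)) = P + star P := by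
  obtain ⟨k, h1, h2, h3⟩ := isEigenvalues_iff.1 h
  have hnorm : ‖(WithLp.toLp 2 ς : EuclideanSpace ℝ (Fin N))‖ = 1 := by
    rw [EuclideanSpace.norm_eq]
    simp [← h.norm_sq, hs]
  -- Since s is a unit vector, ς is a unit vector of ℝ^N. Taking it as the first vector of w makes k
  -- diag(ς) k† = s the first basis vector.
  obtain ⟨w, hw⟩ := Orthonormal.exists_orthonormalBasis_extension_of_card_eq (𝕜 := ℝ)
    (E := EuclideanSpace ℝ (Fin N)) (ι := Fin N) (by simp) (v := fun _ => WithLp.toLp 2 ς)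
    (s := {⟨0, hN⟩}) (by
      rw [orthonormal_iff_ite]
      rintro ⟨i, rfl⟩ ⟨j, rfl⟩
      simp [hnorm])
  obtain ⟨u, hu⟩ := exists_orthonormalBasis (F := F) h1 h2 w
  have hconj (a b : Mat F N) : k * a * star k * (k * b * star k) = k * (a * b) * star k := by
    simp only [mul_assoc]
    rw [← mul_assoc (star k) k, h2, one_mul]
  refine ⟨u, ?_, fun a => ?_, fun q => ?_⟩
  · apply toMat_injective
    rw [hu, adaptedMat, Sum.elim_inl, hw _ (Set.mem_singleton _)]
    change toMat (ofMat (k * Mat.diag ς * star k)) = toMat s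
    rw [← h3, ofMat_toMat]
  · rw [hu, adaptedMat, Sum.elim_inl, toMat_ofMat_of_star_eq (by simp [Mat.star_diag, mul_assoc]), h3]
    change _ * _ = _ * _
    rw [hconj, hconj, Mat.diag_mul_diag, Mat.diag_mul_diag]
    simp only [mul_comm]
  -- The factor ½ is the one in the Hermitian part, so that the basis vector is P + P†.
  · refine ⟨(2⁻¹ : ℝ) • (k * adaptedMat w (Sum.inr q) * star k), ?_, ?_, ?_⟩
    · rw [h3, mul_smul_comm, hconj, adaptedMat, Sum.elim_inr, mul_smul_comm, Mat.diag_mul_single]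
      simp only [mul_smul_comm, smul_mul_assoc]
      module
    · rw [h3, smul_mul_assoc, hconj, adaptedMat, Sum.elim_inr, smul_mul_assoc, Mat.single_mul_diag]
      simp only [mul_smul_comm, smul_mul_assoc]
      module
    · rw [hu, toMat_ofMat, star_smul, star_trivial (2⁻¹ : ℝ), smul_add]

/-- Expanding the double commutator shows that this is -¼ ad_s² applied to u. -/
theorem radialCurvature_one (s u : Herm F N) :
    toMat (Riem.radialCurvature (affineMetric F N) 1 s u) = (4⁻¹ : ℝ) •
      ((2 : ℝ) • (toMat s * toMat u * toMat s) - toMat u * toMat s * toMat s -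
        toMat s * toMat s * toMat u) := by
  rw [Riem.radialCurvature, toMat_curvature one_mem, inv_one]
  simp only [mul_one, two_smul]

theorem radialCurvature_of_commute {s u : Herm F N} (h : Commute (toMat s) (toMat u)) :
    Riem.radialCurvature (affineMetric F N) 1 s u = 0 := by
  apply toMat_injective
  rw [radialCurvature_one, map_zero, h.eq, mul_assoc (toMat s) (toMat s), h.eq,
    ← mul_assoc (toMat s) (toMat u), h.eq]
  module

theorem star_mul_of_mul {s : Herm F N} {P : Mat F N} {b : ℝ} (h : P * toMat s = b • P) :
    toMat s * star P = b • star P := by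
  have := congrArg star h
  rwa [star_mul, star_toMat, star_smul, star_trivial b] at this

theorem mul_star_of_mul {s : Herm F N} {P : Mat F N} {a : ℝ} (h : toMat s * P = a • P) :
    star P * toMat s = a • star P := by
  have := congrArg star h
  rwa [star_mul, star_toMat, star_smul, star_trivial a] at this

/-- Under ad_s the matrix P has eigenvalue a - b and P† has eigenvalue b - a. The squares agree, so
-¼ ad_s² is scalar on their sum. -/
theorem radialCurvature_of_eigen {s u : Herm F N} {P : Mat F N} {a b : ℝ}
    (h1 : toMat s * P = a • P) (h2 : P * toMat s = b • P) (hu : toMat u = P + star P) :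
    Riem.radialCurvature (affineMetric F N) 1 s u = (-((a - b) / 2) ^ 2) • u := by
  apply toMat_injective
  have h3 := star_mul_of_mul h2
  have h4 := mul_star_of_mul h1
  rw [radialCurvature_one, map_smul, hu]
  simp only [mul_add, add_mul, mul_assoc, h1, h2, h3, h4, mul_smul_comm, smul_mul_assoc]
  module

end Herm

end

/-! ### Principal curvatures and bounds for sectional curvatures -/

noncomputable section

variable {F : Scalars} {N : ℕ}

namespace Herm

theorem norm_eq_one_of_affineMetric {s : Herm F N} (hs : affineMetric F N 1 s s = 1) : ‖s‖ = 1 := by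
  rw [affineMetric_one, real_inner_self_eq_norm_sq] at hs
  exact (pow_eq_one_iff_of_nonneg (norm_nonneg s) two_ne_zero).1 hs

theorem exists_principal_orthonormalBasis {s : Herm F N} {ς : Fin N → ℝ} (hN : 1 ≤ N)
    (hs : ‖s‖ = 1) (h : IsEigenvalues s ς) :
    ∃ u : OrthonormalBasis (Fin N ⊕ ({p : Fin N × Fin N // p.1 < p.2} × Fin F.β)) ℝ (Herm F N),
      u (Sum.inl ⟨0, hN⟩) = s ∧
      ∀ a, Riem.radialCurvature (affineMetric F N) 1 s (u a) = principalCurvature ς a • u a := by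
  obtain ⟨u, hu0, hu1, hu2⟩ := exists_adapted_orthonormalBasis hN hs h
  refine ⟨u, hu0, ?_⟩
  rintro (a | q)
  · rw [radialCurvature_of_commute (hu1 a), principalCurvature, Sum.elim_inl, zero_smul]
  · obtain ⟨P, h1, h2, h3⟩ := hu2 q
    rw [radialCurvature_of_eigen h1 h2 h3, principalCurvature, Sum.elim_inr, kappa]

theorem inner_radialCurvature (s u v : Herm F N) :
    inner ℝ (Riem.radialCurvature (affineMetric F N) 1 s u) v = (4⁻¹ : ℝ) *
      (2 * Mat.tr (toMat s * toMat u * toMat s * toMat v) -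
        Mat.tr (toMat u * toMat s * toMat s * toMat v) -
        Mat.tr (toMat s * toMat s * toMat u * toMat v)) := by
  rw [inner_eq_tr, radialCurvature_one]
  simp only [smul_mul_assoc, sub_mul, map_smul, map_sub, smul_eq_mul]

/-- The pair symmetry of the curvature tensor, here a consequence of cyclicity. It allows the first
vector of a plane to play the role of the radial direction. -/
theorem inner_radialCurvature_swap (s u : Herm F N) :
    inner ℝ (Riem.radialCurvature (affineMetric F N) 1 s u) u =
      inner ℝ (Riem.radialCurvature (affineMetric F N) 1 u s) s := by
  rw [inner_radialCurvature, inner_radialCurvature]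
  have h1 : Mat.tr (toMat s * toMat u * toMat s * toMat u) =
      Mat.tr (toMat u * toMat s * toMat u * toMat s) := by
    rw [Mat.tr_mul_comm]
    simp only [mul_assoc]
  have h2 : Mat.tr (toMat u * toMat s * toMat s * toMat u) =
      Mat.tr (toMat u * toMat u * toMat s * toMat s) := by
    rw [Mat.tr_mul_comm]
    simp only [mul_assoc]
  have h3 : Mat.tr (toMat s * toMat u * toMat u * toMat s) =
      Mat.tr (toMat s * toMat s * toMat u * toMat u) := by
    rw [Mat.tr_mul_comm]
    simp only [mul_assoc]
  rw [h1, h2, h3]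
  ring

theorem sectional_one (u v : Herm F N) : Riem.sectional (affineMetric F N) 1 u v =
    inner ℝ (Riem.radialCurvature (affineMetric F N) 1 u v) v /
      (‖u‖ ^ 2 * ‖v‖ ^ 2 - inner ℝ u v ^ 2) := by
  rw [Riem.sectional, affineMetric_one, affineMetric_one, affineMetric_one, affineMetric_one,
    real_inner_self_eq_norm_sq, real_inner_self_eq_norm_sq, inner_radialCurvature_swap]
  rfl

/-- The radial curvature operator at the identity as a linear map. -/
def radialCurvatureLM (s : Herm F N) : Herm F N →ₗ[ℝ] Herm F N where
  toFun := Riem.radialCurvature (affineMetric F N) 1 s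
  map_add' u v := by
    apply toMat_injective
    rw [map_add, radialCurvature_one, radialCurvature_one, radialCurvature_one, map_add]
    simp only [mul_add, add_mul]
    module
  map_smul' r u := by
    apply toMat_injective
    rw [RingHom.id_apply, map_smul, radialCurvature_one, radialCurvature_one, map_smul]
    simp only [mul_smul_comm, smul_mul_assoc]
    module

theorem radialCurvature_eq_sum {ι : Type*} [Fintype ι] {s : Herm F N} {c : ι → ℝ}
    {u : OrthonormalBasis ι ℝ (Herm F N)}
    (h : ∀ a, Riem.radialCurvature (affineMetric F N) 1 s (u a) = c a • u a) (v : Herm F N) :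
    Riem.radialCurvature (affineMetric F N) 1 s v = ∑ a, (c a * inner ℝ (u a) v) • u a := by
  change radialCurvatureLM s v = _
  conv_lhs => rw [← u.sum_repr' v]
  rw [map_sum]
  refine Finset.sum_congr rfl fun a _ => ?_
  rw [map_smul, mul_comm, mul_smul]
  exact congrArg _ (h a)

theorem radialCurvature_smul (r : ℝ) (s u : Herm F N) :
    Riem.radialCurvature (affineMetric F N) 1 (r • s) u =
      r ^ 2 • Riem.radialCurvature (affineMetric F N) 1 s u := by
  apply toMat_injective
  rw [map_smul, radialCurvature_one, radialCurvature_one, map_smul]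
  simp only [mul_smul_comm, smul_mul_assoc]
  module

theorem principalCurvature_nonpos {m : ℕ} (ς : Fin N → ℝ)
    (a : Fin N ⊕ ({p : Fin N × Fin N // p.1 < p.2} × Fin m)) : principalCurvature ς a ≤ 0 := by
  rcases a with a | q
  · exact le_rfl
  · exact neg_nonpos.2 (sq_nonneg _)

theorem kappa_sq_le {ς : Fin N → ℝ} (h : ∑ i, ς i ^ 2 = 1) {i j : Fin N} (hij : i < j) :
    kappa ς i j ^ 2 ≤ 1 / 2 := by
  have h1 : ς i ^ 2 + ς j ^ 2 ≤ 1 := by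
    rw [← h, ← Finset.sum_pair (f := fun i => ς i ^ 2) hij.ne]
    exact Finset.sum_le_sum_of_subset_of_nonneg (Finset.subset_univ _) fun _ _ _ => sq_nonneg _
  rw [kappa]
  -- The identity behind it is (a - b)² + (a + b)² = 2(a² + b²).
  nlinarith [sq_nonneg (ς i + ς j)]

theorem principalCurvature_ge {m : ℕ} {ς : Fin N → ℝ} (h : ∑ i, ς i ^ 2 = 1)
    (a : Fin N ⊕ ({p : Fin N × Fin N // p.1 < p.2} × Fin m)) :
    -1 / 2 ≤ principalCurvature ς a := by
  rcases a with a | q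
  · change (-1 / 2 : ℝ) ≤ 0
    norm_num
  · change (-1 / 2 : ℝ) ≤ -kappa ς q.1.1.1 q.1.1.2 ^ 2
    linarith [kappa_sq_le h q.1.2]

/-- Expand v in the eigenbasis. The component along s has eigenvalue 0, so only the part of v
orthogonal to s is weighted by the eigenvalues in [-½, 0]. -/
theorem inner_radialCurvature_mem (hN : 1 ≤ N) {s : Herm F N} (hs : ‖s‖ = 1) (v : Herm F N) :
    inner ℝ (Riem.radialCurvature (affineMetric F N) 1 s v) v ∈
      Set.Icc (-1 / 2 * (‖v‖ ^ 2 - inner ℝ s v ^ 2)) 0 := by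
  obtain ⟨ς, hς⟩ := exists_isEigenvalues s
  have hsum : ∑ i, ς i ^ 2 = 1 := by rw [← hς.norm_sq, hs, one_pow]
  obtain ⟨u, hu0, hu⟩ := exists_principal_orthonormalBasis hN hs hς
  have h : inner ℝ (Riem.radialCurvature (affineMetric F N) 1 s v) v =
      ∑ a, principalCurvature ς a * inner ℝ (u a) v ^ 2 := by
    rw [radialCurvature_eq_sum hu, sum_inner]
    refine Finset.sum_congr rfl fun a _ => ?_
    rw [real_inner_smul_left]
    ring
  rw [h]
  constructor
  · have h1 : ‖v‖ ^ 2 - inner ℝ s v ^ 2 =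
        ∑ a ∈ Finset.univ.erase (Sum.inl ⟨0, hN⟩), inner ℝ (u a) v ^ 2 := by
      have h2 := u.sum_sq_norm_inner_right v
      simp only [Real.norm_eq_abs, sq_abs] at h2
      rw [← h2, ← Finset.add_sum_erase _ _ (Finset.mem_univ (Sum.inl ⟨0, hN⟩)), hu0]
      ring
    rw [h1, Finset.mul_sum, ← Finset.add_sum_erase _ _ (Finset.mem_univ (Sum.inl ⟨0, hN⟩))]
    change _ ≤ 0 * _ + _
    rw [zero_mul, zero_add]
    exact Finset.sum_le_sum fun a _ =>
      mul_le_mul_of_nonneg_right (principalCurvature_ge hsum a) (sq_nonneg _)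
  · exact Finset.sum_nonpos fun a _ =>
      mul_nonpos_of_nonpos_of_nonneg (principalCurvature_nonpos ς a) (sq_nonneg _)

theorem sectional_one_mem (hN : 1 ≤ N) {u v : Herm F N} (hu : u ≠ 0) :
    Riem.sectional (affineMetric F N) 1 u v ∈ Set.Icc (-1 / 2 : ℝ) 0 := by
  have hpos : 0 < ‖u‖ := norm_pos_iff.2 hu
  have hs : ‖(‖u‖⁻¹ • u)‖ = 1 := by rw [norm_smul, norm_inv, norm_norm, inv_mul_cancel₀ hpos.ne']
  have husmul : u = ‖u‖ • (‖u‖⁻¹ • u) := by rw [smul_smul, mul_inv_cancel₀ hpos.ne', one_smul]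
  obtain ⟨h1, h2⟩ := inner_radialCurvature_mem hN hs v
  have hden : 0 ≤ ‖v‖ ^ 2 - inner ℝ (‖u‖⁻¹ • u) v ^ 2 := by
    have := abs_real_inner_le_norm (‖u‖⁻¹ • u) v
    rw [hs, one_mul] at this
    rw [sub_nonneg]
    exact sq_le_sq' (neg_le_of_abs_le this) (le_of_abs_le this)
  have hsec : Riem.sectional (affineMetric F N) 1 u v =
      inner ℝ (Riem.radialCurvature (affineMetric F N) 1 (‖u‖⁻¹ • u) v) v /
        (‖v‖ ^ 2 - inner ℝ (‖u‖⁻¹ • u) v ^ 2) := by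
    rw [sectional_one]
    conv_lhs => rw [husmul]
    rw [radialCurvature_smul, norm_smul, hs, norm_norm, mul_one, real_inner_smul_left,
      real_inner_smul_left ((‖u‖⁻¹ • u)), mul_pow, ← mul_sub,
      mul_div_mul_left _ _ (by positivity)]
  rw [hsec]
  refine ⟨?_, div_nonpos_of_nonpos_of_nonneg h2 hden⟩
  -- If u and v are dependent the denominator vanishes and the quotient is 0 by convention, which
  -- lies in the interval.
  rcases hden.eq_or_lt with h0 | h0
  · rw [← h0, div_zero]
    norm_num
  · rwa [le_div_iff₀ h0]

theorem sectional_mem (hN : 1 ≤ N) {x : Herm F N} (hx : x ∈ covMatrices F N) {u v : Herm F N}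
    (hu : u ≠ 0) : Riem.sectional (affineMetric F N) x u v ∈ Set.Icc (-1 / 2 : ℝ) 0 := by
  obtain ⟨y, rfl⟩ := exists_exp_eq hx
  rw [sectional_exp]
  refine sectional_one_mem hN fun h => hu ?_
  exact congruence_expHalf_injective y (h.trans (map_zero _).symm)

theorem sectional_of_orthonormal {ι : Type*} [Fintype ι] {s : Herm F N} {c : ι → ℝ}
    {u : OrthonormalBasis ι ℝ (Herm F N)} {a₀ : ι} (h₀ : u a₀ = s)
    (h : ∀ a, Riem.radialCurvature (affineMetric F N) 1 s (u a) = c a • u a) {a : ι} (ha : a ≠ a₀) :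
    Riem.sectional (affineMetric F N) 1 s (u a) = c a := by
  rw [sectional_one, h, real_inner_smul_left, real_inner_self_eq_norm_sq, ← h₀, u.norm_eq_one,
    u.norm_eq_one, u.orthonormal.2 ha.symm]
  norm_num

theorem beta_pos (F : Scalars) : 0 < F.β := by
  cases F <;> simp [Scalars.β]

/-- A unit vector with eigenvalues `1/√2, -1/√2, 0, …, 0`. -/
theorem exists_isEigenvalues_extremal (hN : 2 ≤ N) :
    ∃ (s : Herm F N) (ς : Fin N → ℝ) (i j : Fin N), ‖s‖ = 1 ∧ IsEigenvalues s ς ∧ i < j ∧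
      kappa ς i j = 1 / √2 := by
  let i : Fin N := ⟨0, by omega⟩
  let j : Fin N := ⟨1, by omega⟩
  have hij : i < j := Fin.mk_lt_mk.2 one_pos
  let ς : Fin N → ℝ := fun l => if l = i then 1 / √2 else if l = j then -(1 / √2) else 0
  have hi : ς i = 1 / √2 := if_pos rfl
  have hj : ς j = -(1 / √2) := (if_neg hij.ne').trans (if_pos rfl)
  have hs : IsEigenvalues (ofMat (Mat.diag ς) : Herm F N) ς :=
    isEigenvalues_iff.2 ⟨1, by simp, by simp, by
      rw [toMat_ofMat_of_star_eq (Mat.star_diag ς)]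
      simp⟩
  refine ⟨ofMat (Mat.diag ς), ς, i, j, ?_, hs, hij, ?_⟩
  · have hn := hs.norm_sq
    rw [← Finset.sum_subset (Finset.subset_univ {i, j}), Finset.sum_pair hij.ne, hi, hj, neg_sq,
      div_pow, Real.sq_sqrt zero_le_two] at hn
    · refine (pow_eq_one_iff_of_nonneg (norm_nonneg _) two_ne_zero).1 (hn.trans ?_)
      norm_num
    · intro l _ hl
      rw [Finset.mem_insert, Finset.mem_singleton, not_or] at hl
      have : ς l = 0 := (if_neg hl.1).trans (if_neg hl.2)
      rw [this, sq, mul_zero]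
  · rw [kappa, hi, hj]
    ring

theorem congruence_expHalf_surjective (y : Herm F N) :
    Function.Surjective (congruence (expHalf y)) :=
  (LinearMap.injective_iff_surjective
    (f := ((congruence (expHalf y) : Herm F N →L[ℝ] Herm F N) : Herm F N →ₗ[ℝ] Herm F N))).1
    (congruence_expHalf_injective y)

/-- The bound is attained at the identity on the plane of an extremal s and an eigenvector for its κ
= 1/√2. The isometric congruence pulls this plane back to x. -/
theorem exists_sectional_eq (hN : 2 ≤ N) {x : Herm F N} (hx : x ∈ covMatrices F N) :
    ∃ u v : Herm F N, LinearIndependent ℝ ![u, v] ∧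
      -(1 / √2 : ℝ) ^ 2 = Riem.sectional (affineMetric F N) x u v := by
  obtain ⟨y, rfl⟩ := exists_exp_eq hx
  obtain ⟨s, ς, i, j, hs, hς, hij, hκ⟩ := exists_isEigenvalues_extremal (F := F) hN
  obtain ⟨b, hb0, hb⟩ := exists_principal_orthonormalBasis (by omega) hs hς
  have hsec := sectional_of_orthonormal hb0 hb
    (a := Sum.inr (⟨(i, j), hij⟩, ⟨0, beta_pos F⟩)) (by simp)
  change _ = -kappa ς i j ^ 2 at hsec
  rw [hκ] at hsec
  obtain ⟨u, hu⟩ := congruence_expHalf_surjective y s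
  obtain ⟨v, hv⟩ := congruence_expHalf_surjective y (b (Sum.inr (⟨(i, j), hij⟩, ⟨0, beta_pos F⟩)))
  refine ⟨u, v, ?_, by rw [sectional_exp, hu, hv, hsec]⟩
  refine LinearIndependent.of_comp
    ((congruence (expHalf y) : Herm F N →L[ℝ] Herm F N) : Herm F N →ₗ[ℝ] Herm F N) ?_
  have h := b.orthonormal.linearIndependent.comp
    (![Sum.inl ⟨0, by omega⟩, Sum.inr (⟨(i, j), hij⟩, ⟨0, beta_pos F⟩)] : Fin 2 → _) (by
      intro k l hkl
      fin_cases k <;> fin_cases l <;> simp_all)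
  have hfun : ((congruence (expHalf y) : Herm F N →L[ℝ] Herm F N) : Herm F N →ₗ[ℝ] Herm F N) ∘
      ![u, v] = b ∘ ![Sum.inl ⟨0, by omega⟩, Sum.inr (⟨(i, j), hij⟩, ⟨0, beta_pos F⟩)] := by
    funext k
    fin_cases k
    · exact hu.trans hb0.symm
    · exact hv
  rw [hfun]
  exact h

end Herm

end

/-! ### The scalar Jacobi equation and the curvature matrix in a parallel frame -/

noncomputable section

theorem hasDerivAt_sinhRatio (κ r : ℝ) : HasDerivAt (sinhRatio κ) (Real.cosh (κ * r)) r := by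
  rcases eq_or_ne κ 0 with rfl | hκ
  · have h : sinhRatio 0 = id := funext fun r => if_pos rfl
    rw [h, zero_mul, Real.cosh_zero]
    exact hasDerivAt_id r
  · have h : sinhRatio κ = fun r => Real.sinh (κ * r) / κ := funext fun r => if_neg hκ
    rw [h]
    have h1 := (((hasDerivAt_id r).const_mul κ).sinh).div_const κ
    simpa [hκ] using h1

theorem hasDerivAt_cosh_mul (κ r : ℝ) :
    HasDerivAt (fun r => Real.cosh (κ * r)) (κ ^ 2 * sinhRatio κ r) r := by
  have h1 := ((hasDerivAt_id r).const_mul κ).cosh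
  refine h1.congr_deriv ?_
  rcases eq_or_ne κ 0 with rfl | hκ
  · simp
  · rw [sinhRatio, if_neg hκ]
    simp only [id, mul_one]
    field_simp

theorem deriv_sinhRatio (κ : ℝ) : deriv (sinhRatio κ) = fun r => Real.cosh (κ * r) :=
  funext fun r => (hasDerivAt_sinhRatio κ r).deriv

theorem contDiff_sinhRatio (κ : ℝ) : ContDiff ℝ 2 (sinhRatio κ) := by
  rcases eq_or_ne κ 0 with rfl | hκ
  · have h : sinhRatio 0 = id := funext fun r => if_pos rfl
    rw [h]
    exact contDiff_id
  · have h : sinhRatio κ = fun r => Real.sinh (κ * r) / κ := funext fun r => if_neg hκ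
    rw [h]
    exact (Real.contDiff_sinh.comp (contDiff_const.mul contDiff_id)).div_const κ

theorem sinhRatio_zero_right (κ : ℝ) : sinhRatio κ 0 = 0 := by
  simp [sinhRatio]

theorem sinhRatio_zero_left (r : ℝ) : sinhRatio 0 r = r := if_pos rfl

theorem mul_sinhRatio_mul (κ r : ℝ) : r * sinhRatio (r * κ) 1 = sinhRatio κ r := by
  rcases eq_or_ne κ 0 with rfl | hκ
  · simp [sinhRatio]
  rcases eq_or_ne r 0 with rfl | hr
  · simp [sinhRatio]
  rw [sinhRatio, sinhRatio, if_neg hκ, if_neg (mul_ne_zero hr hκ), mul_one, mul_comm r κ]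
  field_simp

theorem eq_zero_of_hasDerivAt_eq_mul {c : ℝ} {y : ℝ → ℝ} (hy : ∀ t, HasDerivAt y (c * y t) t)
    (h0 : y 0 = 0) (t : ℝ) : y t = 0 := by
  have h (t : ℝ) : HasDerivAt (fun t => y t * Real.exp (-c * t)) 0 t := by
    have h1 := (hy t).mul (((hasDerivAt_id t).const_mul (-c)).exp)
    refine h1.congr_deriv ?_
    simp only [id]
    ring
  have h1 := is_const_of_deriv_eq_zero (fun t => (h t).differentiableAt) (fun t => (h t).deriv) t 0
  simp only [h0, zero_mul] at h1
  exact (mul_eq_zero.1 h1).resolve_right (Real.exp_pos _).ne'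

/-- Uniqueness for y'' = κ²y by factoring the operator as (D + κ)(D - κ). The difference z of the
two solutions gives w = z' - κz with w' = -κw and w(0) = 0, then z' = κz and z(0) = 0. The case κ =
0 is included. -/
theorem eq_mul_sinhRatio {κ p : ℝ} {y y' : ℝ → ℝ} (hy : ∀ t, HasDerivAt y (y' t) t)
    (hy' : ∀ t, HasDerivAt y' (κ ^ 2 * y t) t) (h0 : y 0 = 0) (h1 : y' 0 = p) (t : ℝ) :
    y t = sinhRatio κ t * p := by
  have hz (t : ℝ) := (hy t).sub ((hasDerivAt_sinhRatio κ t).mul_const p)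
  have hz' (t : ℝ) := (hy' t).sub ((hasDerivAt_cosh_mul κ t).mul_const p)
  have hw := eq_zero_of_hasDerivAt_eq_mul (c := -κ)
    (y := fun t => (y' t - Real.cosh (κ * t) * p) - κ * (y t - sinhRatio κ t * p)) (fun t => by
      refine ((hz' t).sub ((hz t).const_mul κ)).congr_deriv ?_
      ring) (by simp [h0, h1, sinhRatio_zero_right])
  have hv := eq_zero_of_hasDerivAt_eq_mul (c := κ) (y := fun t => y t - sinhRatio κ t * p)
    (fun t => (hz t).congr_deriv (sub_eq_zero.1 (hw t))) (by simp [h0, sinhRatio_zero_right])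
  exact sub_eq_zero.1 (hv t)

/-- The square roots `κ` of the numbers `κ² = -λ`, `λ` the eigenvalues of the radial curvature
operator. -/
def principalRate {N m : ℕ} (ς : Fin N → ℝ) :
    Fin N ⊕ ({p : Fin N × Fin N // p.1 < p.2} × Fin m) → ℝ :=
  Sum.elim (fun _ => 0) fun q => kappa ς q.1.1.1 q.1.1.2

theorem principalCurvature_eq {N m : ℕ} (ς : Fin N → ℝ)
    (a : Fin N ⊕ ({p : Fin N × Fin N // p.1 < p.2} × Fin m)) :
    principalCurvature ς a = -principalRate ς a ^ 2 := by
  rcases a with a | q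
  · simp [principalCurvature, principalRate]
  · rfl

/-- The erased index is the direction s itself. The remaining N - 1 diagonal directions have rate 0
and contribute a factor r each. -/
theorem prod_erase_principalRate {N m : ℕ} (hN : 1 ≤ N) (ς : Fin N → ℝ) (r : ℝ) :
    ∏ a ∈ Finset.univ.erase (Sum.inl ⟨0, hN⟩),
      sinhRatio (principalRate (N := N) (m := m) ς a) r =
    r ^ (N - 1) * ∏ i : Fin N, ∏ j ∈ Finset.Ioi i, sinhRatio (kappa ς i j) r ^ m := by
  have h : (Finset.univ.erase (Sum.inl ⟨0, hN⟩) :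
      Finset (Fin N ⊕ ({p : Fin N × Fin N // p.1 < p.2} × Fin m))) =
      (Finset.univ.erase ⟨0, hN⟩).disjSum Finset.univ := by
    ext a
    rcases a with a | q <;> simp
  rw [h, Finset.prod_disjSum]
  congr 1
  · simp [principalRate, sinhRatio_zero_left]
  · rw [Fintype.prod_prod_type]
    simp only [principalRate, Sum.elim_inr, Finset.prod_const, Finset.card_univ, Fintype.card_fin]
    rw [← Finset.prod_subtype (Finset.univ.filter fun p : Fin N × Fin N => p.1 < p.2) (by simp)
      fun p => sinhRatio (kappa ς p.1 p.2) r ^ m, Finset.prod_filter, Fintype.prod_prod_type]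
    refine Finset.prod_congr rfl fun i _ => ?_
    rw [← Finset.prod_filter]
    congr 1
    ext j
    simp

variable {F : Scalars} {N : ℕ}

namespace Herm

theorem expHalf_zero : expHalf (0 : Herm F N) = 1 := by
  rw [expHalf, map_zero, smul_zero, neg_zero, NormedSpace.exp_zero]

/-- The field is e^(ts/2) v e^(ts/2), because of the inverse square root in `expHalf`. It supplies
the parallel frames needed for existence of the Jacobi matrix. -/
theorem isParallel_congruence (s v : Herm F N) :
    Riem.IsParallel (affineMetric F N) (fun t => exp (t • s))
      fun t => congruence (expHalf (-(t • s))) v := by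
  have hd (t : ℝ) : HasDerivAt (fun t : ℝ => congruence (expHalf (-(t • s))) v)
      (ofMat (toMat s * toMat (congruence (expHalf (-(t • s))) v))) t := by
    apply hasDerivAt_of_toMat
    have h := hasDerivAt_expHalf_smul (-s) t
    have h1 := (h.mul_const (toMat v)).mul h
    simp only [smul_neg] at h1
    simp only [toMat_congruence_expHalf]
    refine h1.congr_deriv ?_
    have hcomm := (commute_expHalf_smul (-s) t).eq
    simp only [smul_neg, map_neg, neg_mul, mul_neg, neg_inj] at hcomm
    rw [toMat_ofMat]
    simp only [star_mul, star_toMat, star_expHalf, map_neg, smul_neg, neg_neg, mul_smul_comm,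
      smul_mul_assoc, smul_add, mul_assoc, ← hcomm]
  refine ⟨fun t => (hd t).differentiableAt, fun t => ?_⟩
  rw [(hd t).deriv, deriv_exp_smul, christoffel_eq (exp_mem _), toMat_expVelocity_mul_inv,
    add_neg_cancel]

theorem congruence_expVelocity (s : Herm F N) (t : ℝ) :
    congruence (expHalf (t • s)) (expVelocity s t) = s := by
  apply toMat_injective
  rw [toMat_congruence_expHalf, toMat_expVelocity]
  have hcomm := (commute_expHalf_smul s t).eq
  have h := expHalf_mul_expHalf (t • s)
  rw [inv_exp_smul] at h
  have hcomm' : Commute (NormedSpace.exp (t • toMat s)) (expHalf (t • s)) :=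
    ((commute_expHalf_smul s t).smul_left t).exp_left
  rw [mul_assoc, mul_assoc, hcomm, ← mul_assoc, ← hcomm'.eq, mul_assoc,
    ← mul_assoc (expHalf (t • s)), h, ← mul_assoc, Mat.exp_mul_exp_neg, one_mul]

/-- Transport to the identity makes V, W and the velocity constant, so the curvature coefficients do
not depend on r. This is where local symmetry enters the Jacobi equation. -/
theorem curvature_along {s : Herm F N} {V W : ℝ → Herm F N}
    (hV : Riem.IsParallel (affineMetric F N) (fun t => exp (t • s)) V)
    (hW : Riem.IsParallel (affineMetric F N) (fun t => exp (t • s)) W) (r : ℝ) :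
    affineMetric F N (exp (r • s)) (Riem.radialCurvature (affineMetric F N) (exp (r • s))
      (expVelocity s r) (V r)) (W r) =
      inner ℝ (Riem.radialCurvature (affineMetric F N) 1 s (V 0)) (W 0) := by
  rw [affineMetric_exp, Riem.radialCurvature, congruence_curvature,
    congruence_expHalf_of_isParallel hV, congruence_expHalf_of_isParallel hW,
    congruence_expVelocity, Riem.radialCurvature]

/-- The product of the orthogonal matrix of the frame `e`, in the basis `u`, with its transpose. -/
theorem frame_mul_transpose {ι : Type*} [Fintype ι] [DecidableEq ι] {n : ℕ} {a₀ : ι}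
    {u : OrthonormalBasis ι ℝ (Herm F N)} (σ : Fin n ≃ {a : ι // a ≠ a₀}) {e : Fin n → Herm F N}
    (he : ∀ i j, inner ℝ (e i) (e j) = if i = j then (1 : ℝ) else 0)
    (he₀ : ∀ i, inner ℝ (e i) (u a₀) = (0 : ℝ)) :
    (Matrix.of fun k l => inner ℝ (e k) (u (σ l)) : Matrix (Fin n) (Fin n) ℝ) *
      (Matrix.of fun k l => inner ℝ (e k) (u (σ l)) : Matrix (Fin n) (Fin n) ℝ)ᵀ = 1 := by
  ext k l
  simp only [Matrix.mul_apply, Matrix.of_apply, Matrix.transpose_apply, Matrix.one_apply]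
  rw [σ.sum_comp (fun a : {a : ι // a ≠ a₀} => inner ℝ (e k) (u a) * inner ℝ (e l) (u a)),
    ← he k l, ← u.sum_inner_mul_inner (e k) (e l),
    ← Finset.sum_subtype (Finset.univ.erase a₀) (by simp)
      fun a => inner ℝ (e k) (u a) * inner ℝ (e l) (u a),
    ← Finset.add_sum_erase _ _ (Finset.mem_univ a₀), he₀, zero_mul, zero_add]
  simp only [real_inner_comm]

/-- The spectral decomposition of the operator, written in the frame e. The frame is orthogonal to
the vector with index a₀, so that index drops out of the sums. -/
theorem curvature_matrix_eq {ι : Type*} [Fintype ι] [DecidableEq ι] {n : ℕ} {a₀ : ι}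
    {s : Herm F N} {c : ι → ℝ} {u : OrthonormalBasis ι ℝ (Herm F N)}
    (hu : ∀ a, Riem.radialCurvature (affineMetric F N) 1 s (u a) = c a • u a)
    (σ : Fin n ≃ {a : ι // a ≠ a₀}) {e : Fin n → Herm F N}
    (he₀ : ∀ i, inner ℝ (e i) (u a₀) = (0 : ℝ)) :
    (Matrix.of fun k l => inner ℝ (Riem.radialCurvature (affineMetric F N) 1 s (e l)) (e k) :
      Matrix (Fin n) (Fin n) ℝ) =
      (Matrix.of fun k l => inner ℝ (e k) (u (σ l)) : Matrix (Fin n) (Fin n) ℝ) *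
        Matrix.diagonal (fun l => c (σ l)) *
        (Matrix.of fun k l => inner ℝ (e k) (u (σ l)) : Matrix (Fin n) (Fin n) ℝ)ᵀ := by
  ext k l
  rw [Matrix.mul_apply]
  simp only [Matrix.mul_diagonal, Matrix.of_apply, Matrix.transpose_apply]
  rw [σ.sum_comp (fun a : {a : ι // a ≠ a₀} => inner ℝ (e k) (u a) * c a * inner ℝ (e l) (u a)),
    radialCurvature_eq_sum hu, sum_inner,
    ← Finset.sum_subtype (Finset.univ.erase a₀) (by simp)
      fun a => inner ℝ (e k) (u a) * c a * inner ℝ (e l) (u a),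
    ← Finset.add_sum_erase _ _ (Finset.mem_univ a₀), real_inner_smul_left, real_inner_comm (e k),
    he₀, mul_zero, zero_add]
  refine Finset.sum_congr rfl fun a _ => ?_
  rw [real_inner_smul_left, real_inner_comm (e k), real_inner_comm (e l)]
  ring

theorem exists_equiv_ne {ι : Type*} [Fintype ι] [DecidableEq ι]
    (u : OrthonormalBasis ι ℝ (Herm F N)) (a₀ : ι) :
    Nonempty (Fin (Module.finrank ℝ (Herm F N) - 1) ≃ {a : ι // a ≠ a₀}) := by
  refine ⟨Fintype.equivOfCardEq ?_⟩
  rw [Fintype.card_fin, Module.finrank_eq_card_basis u.toBasis, Fintype.card_subtype_compl,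
    Fintype.card_subtype_eq]

end Herm

end

/-! ### Existence and determinant of the Jacobi matrix -/

noncomputable section

variable {F : Scalars} {N : ℕ}

namespace Herm

/-- The orthogonal matrix O from the frame to the eigenbasis diagonalizes the constant curvature
matrix, so OᵀA = diag(sinhRatio) Oᵀ. The determinant of Oᵀ then cancels. -/
theorem det_of_isJacobiMatrix {ι : Type*} [Fintype ι] [DecidableEq ι] {a₀ : ι} {s : Herm F N}
    {κ : ι → ℝ} {u : OrthonormalBasis ι ℝ (Herm F N)} (hu₀ : u a₀ = s)
    (hu : ∀ a, Riem.radialCurvature (affineMetric F N) 1 s (u a) = (-κ a ^ 2) • u a)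
    {A : ℝ → Matrix _ _ ℝ}
    (hA : Riem.IsJacobiMatrix (affineMetric F N) (covMatrices F N) 1 s A) (r : ℝ) :
    (A r).det = ∏ a ∈ Finset.univ.erase a₀, sinhRatio (κ a) r := by
  obtain ⟨γ, e, hγ, hγ0, hγ1, he, horth, hperp, hC, hA0, hA1, hA2⟩ := hA
  obtain rfl := eq_exp_of_isGeodesic hγ hγ0 hγ1
  obtain ⟨σ⟩ := exists_equiv_ne u a₀
  simp only [affineMetric_one] at horth hperp
  rw [← hu₀] at hperp
  have hO := frame_mul_transpose σ horth hperp
  have hB := curvature_matrix_eq hu σ hperp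
  have hA2' (r : ℝ) (i j) : deriv (deriv fun t => A t i j) r +
      ((Matrix.of fun k l => inner ℝ (Riem.radialCurvature (affineMetric F N) 1 s (e l 0)) (e k 0) :
        Matrix _ _ ℝ) * A r) i j = 0 := by
    have h := hA2 r i j
    rw [deriv_exp_smul] at h
    simp only [curvature_along (he _) (he _)] at h
    exact h
  rw [hB] at hA2'
  generalize (Matrix.of fun k l => inner ℝ (e k 0) (u (σ l)) : Matrix _ _ ℝ) = O at hO hA2'
  have hO' : Oᵀ * O = 1 := mul_eq_one_comm.1 hO
  have hd (i j) (t : ℝ) : HasDerivAt (fun t => A t i j) (deriv (fun t => A t i j) t) t :=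
    ((hC i j).differentiable (by norm_num) t).hasDerivAt
  have hdd (i j) (t : ℝ) : HasDerivAt (deriv fun t => A t i j)
      (-(O * Matrix.diagonal (fun l => -κ (σ l) ^ 2) * Oᵀ * A t) i j) t := by
    have h := (((contDiff_succ_iff_deriv (n := 1)).1 (hC i j)).2.2.differentiable
      (by norm_num) t).hasDerivAt
    rwa [eq_neg_of_add_eq_zero_left (hA2' t i j)] at h
  have hsol : Oᵀ * A r = Matrix.diagonal (fun l => sinhRatio (κ (σ l)) r) * Oᵀ := by
    ext i j
    rw [Matrix.diagonal_mul]
    -- Each entry of row i of OᵀA solves the scalar equation with the rate of the i-th eigenvector.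
    -- Its initial slope is the entry of Oᵀ, because A'(0) = 1.
    refine eq_mul_sinhRatio (y := fun t => (Oᵀ * A t) i j)
      (y' := fun t => ∑ k, Oᵀ i k * deriv (fun t => A t k j) t) (fun t => ?_) (fun t => ?_) ?_ ?_ r
    · simp only [Matrix.mul_apply]
      exact HasDerivAt.fun_sum fun k _ => (hd k j t).const_mul _
    · refine (HasDerivAt.fun_sum fun k _ => (hdd k j t).const_mul (Oᵀ i k)).congr_deriv ?_
      have h : Oᵀ * (O * Matrix.diagonal (fun l => -κ (σ l) ^ 2) * Oᵀ * A t) =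
          Matrix.diagonal (fun l => -κ (σ l) ^ 2) * (Oᵀ * A t) := by
        simp only [mul_assoc]
        rw [← mul_assoc Oᵀ O, hO', one_mul]
      have h1 := congrFun (congrFun h i) j
      rw [Matrix.diagonal_mul, Matrix.mul_apply] at h1
      simp only [mul_neg, Finset.sum_neg_distrib, h1]
      ring
    · simp [hA0]
    · simp only [hA1, Matrix.one_apply, mul_ite, mul_one, mul_zero, Finset.sum_ite_eq',
        Finset.mem_univ, if_true]
  have hdet := congrArg Matrix.det hsol
  have hO1 := congrArg Matrix.det hO
  rw [Matrix.det_mul, Matrix.det_one] at hO1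
  rw [Matrix.det_mul, Matrix.det_mul, Matrix.det_diagonal, mul_comm] at hdet
  rw [mul_right_cancel₀ (right_ne_zero_of_mul_eq_one hO1) hdet,
    σ.prod_comp (fun a : {a : ι // a ≠ a₀} => sinhRatio (κ a) r),
    ← Finset.prod_subtype (Finset.univ.erase a₀) (by simp) fun a => sinhRatio (κ a) r]

/-- In the parallel frame that starts from the eigenvectors other than s, the diagonal matrix of
scalar solutions is a solution. -/
theorem exists_isJacobiMatrix {ι : Type*} [Fintype ι] [DecidableEq ι] {a₀ : ι} {s : Herm F N}
    {κ : ι → ℝ} {u : OrthonormalBasis ι ℝ (Herm F N)} (hu₀ : u a₀ = s)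
    (hu : ∀ a, Riem.radialCurvature (affineMetric F N) 1 s (u a) = (-κ a ^ 2) • u a) :
    ∃ A, Riem.IsJacobiMatrix (affineMetric F N) (covMatrices F N) 1 s A := by
  obtain ⟨σ⟩ := exists_equiv_ne u a₀
  have he0 (l) : congruence (expHalf (-((0 : ℝ) • s))) (u (σ l)) = u (σ l) := by
    apply toMat_injective
    rw [toMat_congruence_expHalf, zero_smul, neg_zero, expHalf_zero, one_mul, mul_one]
  refine ⟨fun r => Matrix.diagonal fun l => sinhRatio (κ (σ l)) r, fun t => exp (t • s),
    fun l t => congruence (expHalf (-(t • s))) (u (σ l)), isGeodesic_exp s, ?_, ?_,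
    fun l => isParallel_congruence s _, fun k l => ?_, fun k => ?_, fun k l => ?_, ?_, fun k l => ?_,
    fun r k l => ?_⟩
  · beta_reduce
    rw [zero_smul, exp_zero]
  · rw [deriv_exp_smul, expVelocity_zero]
  · beta_reduce
    rw [he0, he0, affineMetric_one, orthonormal_iff_ite.1 u.orthonormal]
    exact if_congr (Subtype.val_injective.comp σ.injective).eq_iff rfl rfl
  · beta_reduce
    rw [he0, affineMetric_one, ← hu₀]
    exact u.orthonormal.2 (σ k).2
  · by_cases h : k = l
    · subst h
      simpa only [Matrix.diagonal_apply_eq] using contDiff_sinhRatio _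
    · simpa only [Matrix.diagonal_apply_ne _ h] using contDiff_const
  · ext k l
    by_cases h : k = l
    · subst h
      simp [sinhRatio_zero_right]
    · simp [h]
  · by_cases h : k = l
    · subst h
      simp only [Matrix.diagonal_apply_eq]
      rw [(hasDerivAt_sinhRatio _ _).deriv]
      simp
    · simp [h]
  · rw [deriv_exp_smul]
    simp only [curvature_along (isParallel_congruence s _) (isParallel_congruence s _), he0, hu,
      real_inner_smul_left, orthonormal_iff_ite.1 u.orthonormal]
    rw [Matrix.mul_diagonal, Matrix.of_apply]
    by_cases h : k = l
    · subst h
      simp only [Matrix.diagonal_apply_eq, if_true, mul_one]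
      rw [deriv_sinhRatio, (hasDerivAt_cosh_mul _ _).deriv]
      ring
    · have h' : ¬ ((σ l : ι) = σ k) := fun h' => h (σ.injective (Subtype.ext h')).symm
      simp only [Matrix.diagonal_apply_ne _ h, h', if_false, mul_zero, zero_mul, deriv_const',
        deriv_const, add_zero]

end Herm

end

/-! ### Polar coordinates and the derivative of the matrix exponential -/

noncomputable section

/-- The origin is a null set, and its complement is the product of the unit sphere and the
half-line, with the measure r^(d-1) dr on the second factor. -/
theorem lintegral_polar {E : Type*} [NormedAddCommGroup E] [NormedSpace ℝ E] [MeasurableSpace E]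
    [BorelSpace E] [FiniteDimensional ℝ E] [Nontrivial E] (μ : Measure E) [μ.IsAddHaarMeasure]
    {G : E → ℝ≥0∞} (hG : Measurable G) :
    ∫⁻ x, G x ∂μ = ∫⁻ s : Metric.sphere (0 : E) 1, (∫⁻ r in Set.Ioi (0 : ℝ),
      ENNReal.ofReal (r ^ (Module.finrank ℝ E - 1)) * G (r • (s : E))) ∂μ.toSphere := by
  have hmeas : Measurable fun p : Metric.sphere (0 : E) 1 × Set.Ioi (0 : ℝ) =>
      G ((p.2 : ℝ) • (p.1 : E)) := hG.comp (by fun_prop)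
  calc ∫⁻ x, G x ∂μ = ∫⁻ x : ({(0)}ᶜ : Set E), G x ∂(μ.comap (↑)) := by
        rw [lintegral_subtype_comap (measurableSet_singleton _).compl,
          restrict_compl_singleton]
    _ = ∫⁻ p, G ((p.2 : ℝ) • (p.1 : E))
          ∂μ.toSphere.prod (.volumeIoiPow (Module.finrank ℝ E - 1)) := by
        rw [← μ.measurePreserving_homeomorphUnitSphereProd.lintegral_comp_emb
          (Homeomorph.measurableEmbedding _)]
        refine lintegral_congr fun x => congrArg G ?_
        have := (homeomorphUnitSphereProd E).symm_apply_apply x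
        exact (congrArg Subtype.val this).symm
    _ = ∫⁻ s : Metric.sphere (0 : E) 1, ∫⁻ r : Set.Ioi (0 : ℝ), G ((r : ℝ) • (s : E))
          ∂(.volumeIoiPow (Module.finrank ℝ E - 1)) ∂μ.toSphere :=
        lintegral_prod _ hmeas.aemeasurable
    _ = _ := by
        refine lintegral_congr fun s => ?_
        have hm : Measurable fun r : Set.Ioi (0 : ℝ) => G ((r : ℝ) • (s : E)) :=
          hmeas.comp measurable_prodMk_left
        refine (lintegral_withDensity_eq_lintegral_mul _ (by fun_prop) hm).trans ?_
        exact lintegral_subtype_comap measurableSet_Ioi fun r =>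
          ENNReal.ofReal (r ^ (Module.finrank ℝ E - 1)) * G (r • (s : E))

variable {F : Scalars} {N : ℕ}

namespace Mat

/-- The hypothesis says that P intertwines the scalar a with x, and an intertwiner also intertwines
the exponentials. -/
theorem exp_mul_of_mul {x P : Mat F N} {a : ℝ} (h : x * P = a • P) :
    NormedSpace.exp x * P = Real.exp a • P := by
  have h1 : SemiconjBy P (algebraMap ℝ (Mat F N) a) x := by
    rw [SemiconjBy, h, Algebra.algebraMap_eq_smul_one, mul_smul_comm, mul_one]
  have h2 := h1.exp_right
  rw [SemiconjBy, ← NormedSpace.algebraMap_exp_comm, ← Real.exp_eq_exp_ℝ,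
    Algebra.algebraMap_eq_smul_one, mul_smul_comm, mul_one] at h2
  exact h2.symm

theorem mul_exp_of_mul {x P : Mat F N} {b : ℝ} (h : P * x = b • P) :
    P * NormedSpace.exp x = Real.exp b • P := by
  have h1 : SemiconjBy P x (algebraMap ℝ (Mat F N) b) := by
    rw [SemiconjBy, h, Algebra.algebraMap_eq_smul_one, smul_mul_assoc, one_mul]
  have h2 := h1.exp_right
  rwa [SemiconjBy, ← NormedSpace.algebraMap_exp_comm, ← Real.exp_eq_exp_ℝ,
    Algebra.algebraMap_eq_smul_one, smul_mul_assoc, one_mul] at h2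

theorem differentiable_exp : Differentiable ℝ (NormedSpace.exp : Mat F N → Mat F N) :=
  fun a => (NormedSpace.exp_analytic (𝕂 := ℝ) a).differentiableAt

theorem fderiv_exp_of_line {x P Q : Mat F N}
    (h : HasDerivAt (fun t : ℝ => NormedSpace.exp (x + t • P)) Q 0) :
    fderiv ℝ (NormedSpace.exp : Mat F N → Mat F N) x P = Q := by
  have h1 : HasDerivAt (fun t : ℝ => x + t • P) P 0 := by
    simpa using! ((hasDerivAt_id (0 : ℝ)).smul_const P).const_add x
  have h2 : HasFDerivAt (NormedSpace.exp : Mat F N → Mat F N)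
      (fderiv ℝ (NormedSpace.exp : Mat F N → Mat F N) x) (x + (0 : ℝ) • P) := by
    rw [zero_smul, add_zero]
    exact (differentiable_exp x).hasFDerivAt
  exact (h2.comp_hasDerivAt (0 : ℝ) h1).unique h

theorem fderiv_exp_of_commute {x P : Mat F N} (h : Commute x P) :
    fderiv ℝ (NormedSpace.exp : Mat F N → Mat F N) x P = NormedSpace.exp x * P := by
  apply fderiv_exp_of_line
  have h1 (t : ℝ) : NormedSpace.exp (x + t • P) = NormedSpace.exp x * NormedSpace.exp (t • P) :=
    NormedSpace.exp_add_of_commute (h.smul_right t)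
  simp only [h1]
  refine ((hasDerivAt_exp_smul P 0).const_mul (NormedSpace.exp x)).congr_deriv ?_
  rw [zero_smul, NormedSpace.exp_zero, one_mul]

/-- Computing PxP in two ways gives P² = 0 when a ≠ b. Hence x + tP is the conjugate of x by 1 + X
with X = -(t/(a - b))P, whose inverse is 1 - X, and exp commutes with conjugation. So exp is affine
along this line and its derivative can be read off. -/
theorem exp_add_smul_of_ne {x P : Mat F N} {a b : ℝ} (h1 : x * P = a • P) (h2 : P * x = b • P)
    (hab : a ≠ b) (t : ℝ) : NormedSpace.exp (x + t • P) =
      NormedSpace.exp x + t • (((Real.exp a - Real.exp b) / (a - b)) • P) := by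
  have hab' : a - b ≠ 0 := sub_ne_zero.2 hab
  have hPP : P * P = 0 := by
    have h : a • (P * P) = b • (P * P) := by
      rw [← mul_smul_comm, ← h1, ← mul_assoc, h2, smul_mul_assoc]
    rw [← sub_eq_zero, ← sub_smul] at h
    exact (smul_eq_zero.1 h).resolve_left hab'
  let X : Mat F N := (-(t / (a - b))) • P
  have hXX : X * X = 0 := by simp [X, hPP]
  let U : (Mat F N)ˣ := ⟨1 + X, 1 - X, by
    rw [add_mul, mul_sub, mul_sub, hXX]
    simp, by
    rw [sub_mul, mul_add, mul_add, hXX]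
    simp⟩
  -- Stated for a general y because it is applied both to x and to exp x, which share the
  -- eigenmatrix P.
  have hconj (y : Mat F N) (p q : ℝ) (hp : y * P = p • P) (hq : P * y = q • P) :
      (1 + X) * y * (1 - X) = y + t • (((p - q) / (a - b)) • P) := by
    have e1 : X * y = (-(t / (a - b)) * q) • P := by
      simp only [X, smul_mul_assoc, hq, smul_smul]
    have e2 : y * X = (-(t / (a - b)) * p) • P := by
      simp only [X, mul_smul_comm, hp, smul_smul]
    have e3 : X * y * X = 0 := by
      rw [e1]
      simp [X, hPP]
    have e4 : (1 + X) * y * (1 - X) = y + X * y - y * X - X * y * X := by noncomm_ring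
    rw [e4, e3, e1, e2, sub_zero, smul_smul, add_sub_assoc, ← sub_smul]
    congr 2
    ring
  have hx := hconj x a b h1 h2
  rw [div_self hab', one_smul] at hx
  rw [← hx, ← hconj (NormedSpace.exp x) _ _ (exp_mul_of_mul h1) (mul_exp_of_mul h2)]
  exact NormedSpace.exp_units_conj U x

/-- The divided difference of the exponential function. -/
def expDivDiff (a b : ℝ) : ℝ :=
  if a = b then Real.exp a else (Real.exp a - Real.exp b) / (a - b)

theorem fderiv_exp_of_eigen {x P : Mat F N} {a b : ℝ} (h1 : x * P = a • P) (h2 : P * x = b • P) :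
    fderiv ℝ (NormedSpace.exp : Mat F N → Mat F N) x P = expDivDiff a b • P := by
  rcases eq_or_ne a b with rfl | hab
  · rw [fderiv_exp_of_commute (h1.trans h2.symm), exp_mul_of_mul h1, expDivDiff, if_pos rfl]
  · apply fderiv_exp_of_line
    simp only [exp_add_smul_of_ne h1 h2 hab, expDivDiff, if_neg hab]
    simpa using! ((hasDerivAt_id (0 : ℝ)).smul_const
      (((Real.exp a - Real.exp b) / (a - b)) • P)).const_add (NormedSpace.exp x)

/-- Multiplying the divided difference by e^(-(a+b)/2) symmetrizes it: (e^κ - e^(-κ))/(2κ) with κ =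
(a - b)/2. -/
theorem exp_mul_expDivDiff (a b : ℝ) :
    Real.exp (-(2⁻¹ * a)) * (expDivDiff a b * Real.exp (-(2⁻¹ * b))) =
      sinhRatio ((a - b) / 2) 1 := by
  rw [mul_left_comm, ← Real.exp_add, expDivDiff, sinhRatio]
  rcases eq_or_ne a b with rfl | hab
  · rw [if_pos rfl, if_pos (by simp), ← Real.exp_add]
    ring_nf
    exact Real.exp_zero
  · have hab' : a - b ≠ 0 := sub_ne_zero.2 hab
    rw [if_neg hab, if_neg (div_ne_zero hab' two_ne_zero), mul_one, Real.sinh_eq, div_mul_eq_mul_div,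
      sub_mul, ← Real.exp_add, ← Real.exp_add]
    have e1 : a + (-(2⁻¹ * a) + -(2⁻¹ * b)) = (a - b) / 2 := by ring
    have e2 : b + (-(2⁻¹ * a) + -(2⁻¹ * b)) = -((a - b) / 2) := by ring
    rw [e1, e2]
    field_simp

end Mat

namespace Herm

theorem toMat_fderiv_exp (y u : Herm F N) : toMat (fderiv ℝ exp y u) =
    fderiv ℝ (NormedSpace.exp : Mat F N → Mat F N) (toMat y) (toMat u) := by
  have h1 : HasFDerivAt (fun y : Herm F N => toMat (exp y)) (toMat ∘L fderiv ℝ exp y) y :=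
    (toMat (F := F) (N := N)).hasFDerivAt.comp y
      ((contDiff_exp.differentiable (by simp)) y).hasFDerivAt
  have h2 : HasFDerivAt (fun y : Herm F N => toMat (exp y))
      (fderiv ℝ (NormedSpace.exp : Mat F N → Mat F N) (toMat y) ∘L toMat) y := by
    simp only [toMat_exp]
    exact ((Mat.differentiable_exp (toMat y)).hasFDerivAt.comp y (toMat (F := F) (N := N)).hasFDerivAt)
  exact congrArg (fun f : Herm F N →L[ℝ] Mat F N => f u) (h1.unique h2)

theorem congruence_fderiv_exp_of_commute {y u : Herm F N} (h : Commute (toMat y) (toMat u)) :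
    congruence (expHalf y) (fderiv ℝ exp y u) = u := by
  apply toMat_injective
  have h1 : Commute (toMat u) (expHalf y) := (h.symm.smul_right (2⁻¹ : ℝ)).neg_right.exp_right
  have h2 : Commute (expHalf y) (NormedSpace.exp (toMat y)) :=
    (((Commute.refl (toMat y)).smul_left (2⁻¹ : ℝ)).neg_left).exp
  rw [toMat_congruence_expHalf, toMat_fderiv_exp, Mat.fderiv_exp_of_commute h, mul_assoc, mul_assoc,
    h1.eq, ← mul_assoc, h2.eq, mul_assoc, ← mul_assoc (expHalf y), expHalf_mul_expHalf, inv_exp,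
    ← mul_assoc, Mat.exp_mul_exp_neg, one_mul]

/-- Both P and P† are scaled, with (a,b) exchanged for P†. The factor sinh(κ)/κ is even in κ, so
their sum is an eigenvector. -/
theorem congruence_fderiv_exp_of_eigen {y u : Herm F N} {P : Mat F N} {a b : ℝ}
    (h1 : toMat y * P = a • P) (h2 : P * toMat y = b • P) (hu : toMat u = P + star P) :
    congruence (expHalf y) (fderiv ℝ exp y u) = sinhRatio ((a - b) / 2) 1 • u := by
  have key {P : Mat F N} {a b : ℝ} (h1 : toMat y * P = a • P) (h2 : P * toMat y = b • P) :
      expHalf y * fderiv ℝ (NormedSpace.exp : Mat F N → Mat F N) (toMat y) P * expHalf y =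
        sinhRatio ((a - b) / 2) 1 • P := by
    have e1 : expHalf y * P = Real.exp (-(2⁻¹ * a)) • P := Mat.exp_mul_of_mul (by
      rw [neg_mul, smul_mul_assoc, h1, smul_smul, neg_smul])
    have e2 : P * expHalf y = Real.exp (-(2⁻¹ * b)) • P := Mat.mul_exp_of_mul (by
      rw [mul_neg, mul_smul_comm, h2, smul_smul, neg_smul])
    rw [Mat.fderiv_exp_of_eigen h1 h2, mul_assoc, smul_mul_assoc, e2, mul_smul_comm, mul_smul_comm,
      e1, smul_smul, smul_smul, ← Mat.exp_mul_expDivDiff]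
    congr 1
    ring
  apply toMat_injective
  have hsymm : sinhRatio ((b - a) / 2) 1 = sinhRatio ((a - b) / 2) 1 := by
    rw [← neg_sub a b, neg_div]
    generalize (a - b) / 2 = κ
    simp [sinhRatio, neg_div_neg_eq]
  rw [toMat_congruence_expHalf, toMat_fderiv_exp, map_smul, hu, map_add, mul_add, add_mul,
    key h1 h2, key (star_mul_of_mul h2) (mul_star_of_mul h1), hsymm, smul_add]

end Herm

end

/-! ### The Riemannian volume in geodesic polar coordinates -/

noncomputable section

variable {F : Scalars} {N : ℕ}

namespace Herm

theorem det_congruence_fderiv_exp (hN : 1 ≤ N) {s : Herm F N} {ς : Fin N → ℝ} (hs : ‖s‖ = 1)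
    (h : IsEigenvalues s ς) (r : ℝ) :
    (congruence (expHalf (r • s)) ∘L fderiv ℝ exp (r • s)).det =
      ∏ a ∈ (Finset.univ : Finset (Fin N ⊕ ({p : Fin N × Fin N // p.1 < p.2} × Fin F.β))).erase
        (Sum.inl ⟨0, hN⟩), sinhRatio (r * principalRate ς a) 1 := by
  obtain ⟨u, -, hu1, hu2⟩ := exists_adapted_orthonormalBasis hN hs h
  have key (a) : congruence (expHalf (r • s)) (fderiv ℝ exp (r • s) (u a)) =
      sinhRatio (r * principalRate ς a) 1 • u a := by
    rcases a with a | q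
    · rw [congruence_fderiv_exp_of_commute (by rw [map_smul]; exact (hu1 a).smul_left r)]
      simp [principalRate, sinhRatio_zero_left]
    · obtain ⟨P, h1, h2, h3⟩ := hu2 q
      rw [congruence_fderiv_exp_of_eigen (a := r * ς q.1.1.1) (b := r * ς q.1.1.2)
        (by rw [map_smul, smul_mul_assoc, h1, smul_smul])
        (by rw [map_smul, mul_smul_comm, h2, smul_smul]) h3]
      simp only [principalRate, kappa, Sum.elim_inr, mul_sub, mul_div_assoc, sub_div]
  have hmat : LinearMap.toMatrix u.toBasis u.toBasis
      (congruence (expHalf (r • s)) ∘L fderiv ℝ exp (r • s) : Herm F N →L[ℝ] Herm F N).toLinearMap =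
      Matrix.diagonal fun a => sinhRatio (r * principalRate ς a) 1 := by
    ext a b
    rw [LinearMap.toMatrix_apply]
    have e : (congruence (expHalf (r • s)) ∘L fderiv ℝ exp (r • s) :
        Herm F N →L[ℝ] Herm F N).toLinearMap (u.toBasis b) =
        sinhRatio (r * principalRate ς b) 1 • u.toBasis b := by
      rw [OrthonormalBasis.coe_toBasis]
      exact key b
    rw [e, map_smul, Module.Basis.repr_self, Finsupp.smul_single, Finsupp.single_apply,
      Matrix.diagonal_apply, smul_eq_mul, mul_one]
    rcases eq_or_ne a b with rfl | hab
    · simp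
    · simp [hab, hab.symm]
  change LinearMap.det _ = _
  rw [← LinearMap.det_toMatrix u.toBasis, hmat, Matrix.det_diagonal,
    ← Finset.mul_prod_erase _ _ (Finset.mem_univ (Sum.inl ⟨0, hN⟩))]
  simp [principalRate, sinhRatio_zero_left]

/-- There are d - 1 factors left after erasing the direction s, so each receives one r from the
polar Jacobian, and r · sinhRatio (rκ) 1 = sinhRatio κ r. This matches the Jacobi determinant. -/
theorem pow_mul_det_congruence_fderiv_exp (hN : 1 ≤ N) {s : Herm F N} {ς : Fin N → ℝ}
    (hs : ‖s‖ = 1) (h : IsEigenvalues s ς) (r : ℝ) :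
    r ^ (Module.finrank ℝ (Herm F N) - 1) *
      (congruence (expHalf (r • s)) ∘L fderiv ℝ exp (r • s)).det =
      ∏ a ∈ (Finset.univ : Finset (Fin N ⊕ ({p : Fin N × Fin N // p.1 < p.2} × Fin F.β))).erase
        (Sum.inl ⟨0, hN⟩), sinhRatio (principalRate ς a) r := by
  obtain ⟨u, -⟩ := exists_adapted_orthonormalBasis hN hs h
  rw [det_congruence_fderiv_exp hN hs h, Module.finrank_eq_card_basis u.toBasis,
    ← Finset.card_univ, ← Finset.card_erase_of_mem (Finset.mem_univ (Sum.inl ⟨0, hN⟩)),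
    ← Finset.prod_const, ← Finset.prod_mul_distrib]
  exact Finset.prod_congr rfl fun a _ => mul_sinhRatio_mul _ _

/-- The Riemannian volume density in orthonormal coordinates. -/
def density (x : Herm F N) : ℝ :=
  √(Matrix.det (Matrix.of fun i j => affineMetric F N x
    (stdOrthonormalBasis ℝ (Herm F N) i) (stdOrthonormalBasis ℝ (Herm F N) j)))

/-- By the isometry property the Gram matrix is CᵀC, with C the matrix of the congruence, so the
root of its determinant is |det C|. -/
theorem density_exp (y : Herm F N) : density (exp y) = |(congruence (expHalf y)).det| := by
  let b := stdOrthonormalBasis ℝ (Herm F N)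
  have h : (Matrix.of fun i j => affineMetric F N (exp y) (b i) (b j)) =
      (LinearMap.toMatrix b.toBasis b.toBasis (congruence (expHalf y)).toLinearMap)ᵀ *
        LinearMap.toMatrix b.toBasis b.toBasis (congruence (expHalf y)).toLinearMap := by
    ext i j
    rw [Matrix.of_apply, affineMetric_exp, ← b.sum_inner_mul_inner, Matrix.mul_apply]
    refine Finset.sum_congr rfl fun k _ => ?_
    rw [Matrix.transpose_apply, LinearMap.toMatrix_apply, LinearMap.toMatrix_apply,
      real_inner_comm, b.coe_toBasis, b.coe_toBasis_repr_apply, b.coe_toBasis_repr_apply,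
      b.repr_apply_apply, b.repr_apply_apply]
    rfl
  rw [density]
  change √(Matrix.det (Matrix.of fun i j => affineMetric F N (exp y) (b i) (b j))) = _
  rw [h, Matrix.det_mul, Matrix.det_transpose, LinearMap.det_toMatrix, Real.sqrt_mul_self_eq_abs]

theorem density_exp_mul (y : Herm F N) : |(fderiv ℝ exp y).det| * density (exp y) =
    |(congruence (expHalf y) ∘L fderiv ℝ exp y).det| := by
  rw [density_exp, mul_comm, ← abs_mul]
  congr 1
  exact (LinearMap.det_comp _ _).symm

theorem continuousOn_density : ContinuousOn (density : Herm F N → ℝ) (covMatrices F N) := by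
  have hinv : ContinuousOn (inv : Herm F N → Mat F N) (covMatrices F N) := fun x hx =>
    (hasFDerivAt_inv hx).continuousAt.continuousWithinAt
  refine Real.continuous_sqrt.comp_continuousOn ?_
  refine (Continuous.matrix_det continuous_id).comp_continuousOn ?_
  refine continuousOn_pi.2 fun i => continuousOn_pi.2 fun j => ?_
  simp only [Matrix.of_apply, affineMetric_eq]
  fun_prop

/-- Change of variables along exp, which is injective with image `M`. The density and the Jacobian
of exp combine into the determinant of one composed map. -/
theorem lintegral_riemVolume {f : Herm F N → ℝ≥0∞} (hf : Measurable f) :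
    ∫⁻ x, f x ∂(Riem.riemVolume (affineMetric F N) (covMatrices F N)) =
      ∫⁻ y : Herm F N, ENNReal.ofReal |(congruence (expHalf y) ∘L fderiv ℝ exp y).det| *
        f (exp y) := by
  have hM : MeasurableSet (covMatrices F N) := isOpen_covMatrices.measurableSet
  have hd : AEMeasurable (fun x : Herm F N => ENNReal.ofReal (density x))
      (volume.restrict (covMatrices F N)) :=
    (continuousOn_density.aemeasurable hM).ennreal_ofReal
  have hexp (y : Herm F N) : HasFDerivAt exp (fderiv ℝ exp y) y :=
    ((contDiff_exp.differentiable (by simp)) y).hasFDerivAt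
  calc _ = ∫⁻ x in covMatrices F N, ENNReal.ofReal (density x) * f x :=
        lintegral_withDensity_eq_lintegral_mul₀ hd hf.aemeasurable
    _ = ∫⁻ x in exp '' (Set.univ : Set (Herm F N)), ENNReal.ofReal (density x) * f x := by
        rw [Set.image_univ, range_exp]
    _ = ∫⁻ y in (Set.univ : Set (Herm F N)), ENNReal.ofReal |(fderiv ℝ exp y).det| *
          (ENNReal.ofReal (density (exp y)) * f (exp y)) :=
        lintegral_image_eq_lintegral_abs_det_fderiv_mul volume MeasurableSet.univ
          (fun y _ => (hexp y).hasFDerivWithinAt) exp_injective.injOn _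
    _ = _ := by
        rw [setLIntegral_univ]
        refine lintegral_congr fun y => ?_
        rw [← mul_assoc, ← ENNReal.ofReal_mul (abs_nonneg _), density_exp_mul]

theorem nontrivial (hN : 1 ≤ N) : Nontrivial (Herm F N) := by
  refine ⟨⟨0, 1, fun h => ?_⟩⟩
  have h1 := congrArg (fun x : Herm F N => mat x ⟨0, hN⟩ ⟨0, hN⟩) h
  change (0 : F.K) = (1 : Matrix (Fin N) (Fin N) F.K) ⟨0, hN⟩ ⟨0, hN⟩ at h1
  rw [Matrix.one_apply_eq] at h1
  exact zero_ne_one h1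

theorem continuous_exp : Continuous (exp : Herm F N → Herm F N) := contDiff_exp.continuous

theorem measurable_abs_det_congruence_fderiv_exp : Measurable fun y : Herm F N =>
    |(congruence (expHalf y) ∘L fderiv ℝ exp y).det| := by
  have h1 : Continuous (fderiv ℝ (exp : Herm F N → Herm F N)) :=
    contDiff_exp.continuous_fderiv (by simp)
  have h2 : Continuous fun y : Herm F N => density (exp y) :=
    continuousOn_density.comp_continuous continuous_exp exp_mem
  -- As a product of |det dexp| and the density at exp y, the function is visibly continuous.
  simp only [← density_exp_mul]
  exact ((ContinuousLinearMap.continuous_det.comp h1).abs.mul h2).measurable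

theorem det_of_isJacobiMatrix_of_isEigenvalues (hN : 1 ≤ N) {s : Herm F N} {ς : Fin N → ℝ}
    (hs : ‖s‖ = 1) (h : IsEigenvalues s ς) {A : ℝ → Matrix _ _ ℝ}
    (hA : Riem.IsJacobiMatrix (affineMetric F N) (covMatrices F N) 1 s A) (r : ℝ) :
    (A r).det = ∏ a ∈ (Finset.univ :
      Finset (Fin N ⊕ ({p : Fin N × Fin N // p.1 < p.2} × Fin F.β))).erase
        (Sum.inl ⟨0, hN⟩), sinhRatio (principalRate ς a) r := by
  obtain ⟨u, hu₀, hu⟩ := exists_principal_orthonormalBasis hN hs h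
  exact det_of_isJacobiMatrix hu₀ (fun a => (hu a).trans (by rw [principalCurvature_eq])) hA r

theorem lintegral_riemVolume_polar (hN : 1 ≤ N)
    (A : Metric.sphere (0 : Herm F N) 1 → ℝ → Matrix _ _ ℝ)
    (hA : ∀ s : Metric.sphere (0 : Herm F N) 1,
      Riem.IsJacobiMatrix (affineMetric F N) (covMatrices F N) 1 s (A s))
    {f : Herm F N → ℝ≥0∞} (hf : Measurable f) :
    ∫⁻ x, f x ∂(Riem.riemVolume (affineMetric F N) (covMatrices F N)) =
      ∫⁻ s : Metric.sphere (0 : Herm F N) 1, (∫⁻ r in Set.Ioi (0 : ℝ),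
        f (Riem.riemExp (affineMetric F N) (covMatrices F N) 1 (r • (s : Herm F N))) *
          ENNReal.ofReal |(A s r).det|)
        ∂(volume : Measure (Herm F N)).toSphere := by
  have := nontrivial (F := F) hN
  rw [lintegral_riemVolume hf]
  refine (lintegral_polar volume (measurable_abs_det_congruence_fderiv_exp.ennreal_ofReal.mul
    (hf.comp continuous_exp.measurable))).trans ?_
  refine lintegral_congr fun s => setLIntegral_congr_fun measurableSet_Ioi fun r hr => ?_
  have hs : ‖(s : Herm F N)‖ = 1 := mem_sphere_zero_iff_norm.1 s.2
  obtain ⟨ς, h⟩ := exists_isEigenvalues (s : Herm F N)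
  have hr' : 0 ≤ r ^ (Module.finrank ℝ (Herm F N) - 1) := pow_nonneg (le_of_lt hr) _
  rw [Pi.mul_apply, Function.comp_apply, riemExp_one,
    det_of_isJacobiMatrix_of_isEigenvalues hN hs h (hA s),
    ← pow_mul_det_congruence_fderiv_exp hN hs h, abs_mul,
    abs_of_nonneg hr', ENNReal.ofReal_mul hr', ← mul_assoc, mul_comm (f _)]

end Herm

end

/-! ### The main theorem -/

theorem mainTheorem2 (F : Scalars) (N : ℕ) (hN : 1 ≤ N) :
    -- every Hermitian matrix has a list of `N` real eigenvalues
    (∀ s : Herm F N, ∃ ς : Fin N → ℝ, IsEigenvalues s ς) ∧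
    -- the matrix `A(r,s)` exists, and its determinant is given by the formula
    (∀ s : Herm F N, affineMetric F N 1 s s = 1 →
      (∃ A, Riem.IsJacobiMatrix (affineMetric F N) (covMatrices F N) 1 s A) ∧
      ∀ A, Riem.IsJacobiMatrix (affineMetric F N) (covMatrices F N) 1 s A →
        ∀ ς : Fin N → ℝ, IsEigenvalues s ς → ∀ r : ℝ, 0 ≤ r →
          (A r).det = r ^ (N - 1) *
            ∏ i : Fin N, ∏ j ∈ Finset.Ioi i, sinhRatio (kappa ς i j) r ^ F.β) ∧
    -- `|det A(r,s)|` is the Riemannian volume density in geodesic polar coordinates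
    (∀ A : Metric.sphere (0 : Herm F N) 1 → ℝ → Matrix _ _ ℝ,
      (∀ s : Metric.sphere (0 : Herm F N) 1,
        Riem.IsJacobiMatrix (affineMetric F N) (covMatrices F N) 1 s (A s)) →
      ∀ f : Herm F N → ℝ≥0∞, Measurable f →
        ∫⁻ x, f x ∂(Riem.riemVolume (affineMetric F N) (covMatrices F N)) =
          ∫⁻ s : Metric.sphere (0 : Herm F N) 1, (∫⁻ r in Set.Ioi (0 : ℝ),
            f (Riem.riemExp (affineMetric F N) (covMatrices F N) 1 (r • (s : Herm F N))) *
              ENNReal.ofReal |(A s r).det|)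
            ∂(volume : Measure (Herm F N)).toSphere) ∧
    -- principal curvatures
    (∀ (s : Herm F N) (ς : Fin N → ℝ), affineMetric F N 1 s s = 1 → IsEigenvalues s ς →
      ∃ u : OrthonormalBasis (Fin N ⊕ ({p : Fin N × Fin N // p.1 < p.2} × Fin F.β)) ℝ (Herm F N),
        u (Sum.inl ⟨0, hN⟩) = s ∧
        (∀ a, Riem.radialCurvature (affineMetric F N) 1 s (u a) =
          principalCurvature ς a • u a) ∧
        ∀ a, a ≠ Sum.inl ⟨0, hN⟩ →
          Riem.sectional (affineMetric F N) 1 s (u a) = principalCurvature ς a) ∧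
    -- bounds for the sectional curvatures at every point
    (∀ x ∈ covMatrices F N, ∀ u v : Herm F N, LinearIndependent ℝ ![u, v] →
      Riem.sectional (affineMetric F N) x u v ∈ Set.Icc (-1 / 2 : ℝ) 0) ∧
    -- the least sectional curvature is `-κ²` with `κ = 1/√2`
    (2 ≤ N →
      (∀ x ∈ covMatrices F N,
        IsLeast {c | ∃ u v : Herm F N, LinearIndependent ℝ ![u, v] ∧
          c = Riem.sectional (affineMetric F N) x u v} (-(1 / √2 : ℝ) ^ 2)) ∧
      IsLeast {c | ∃ (s : Herm F N) (ς : Fin N → ℝ) (i j : Fin N), affineMetric F N 1 s s = 1 ∧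
        IsEigenvalues s ς ∧ i < j ∧ c = -kappa ς i j ^ 2} (-(1 / √2 : ℝ) ^ 2)) := by
  have hκ : (-(1 / √2 : ℝ) ^ 2) = -1 / 2 := by
    rw [div_pow, Real.sq_sqrt two_pos.le, one_pow, neg_div]
  refine ⟨exists_isEigenvalues, fun s hs => ⟨?_, fun A hA ς h r _ => ?_⟩,
    fun A hA f hf => Herm.lintegral_riemVolume_polar hN A hA hf, fun s ς hs h => ?_,
    fun x hx u v huv => Herm.sectional_mem hN hx (huv.ne_zero 0), fun hN2 => ⟨fun x hx => ?_, ?_⟩⟩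
  · obtain ⟨ς, h⟩ := exists_isEigenvalues s
    obtain ⟨u, hu₀, hu⟩ :=
      Herm.exists_principal_orthonormalBasis hN (Herm.norm_eq_one_of_affineMetric hs) h
    exact Herm.exists_isJacobiMatrix hu₀ fun a => (hu a).trans (by rw [principalCurvature_eq])
  · rw [Herm.det_of_isJacobiMatrix_of_isEigenvalues hN (Herm.norm_eq_one_of_affineMetric hs) h hA,
      prod_erase_principalRate]
  · obtain ⟨u, hu₀, hu⟩ :=
      Herm.exists_principal_orthonormalBasis hN (Herm.norm_eq_one_of_affineMetric hs) h
    exact ⟨u, hu₀, hu, fun a ha => Herm.sectional_of_orthonormal hu₀ hu ha⟩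
  · refine ⟨Herm.exists_sectional_eq hN2 hx, ?_⟩
    rintro _ ⟨u, v, huv, rfl⟩
    rw [hκ]
    exact (Herm.sectional_mem hN hx (huv.ne_zero 0)).1
  · constructor
    · obtain ⟨s, ς, i, j, hs, h, hij, hk⟩ := Herm.exists_isEigenvalues_extremal (F := F) hN2
      exact ⟨s, ς, i, j, by rw [affineMetric_one, real_inner_self_eq_norm_sq, hs, one_pow], h, hij,
        by rw [hk]⟩
    · rintro _ ⟨s, ς, i, j, hs, h, hij, rfl⟩
      have h1 := Herm.kappa_sq_le (h.norm_sq.symm.trans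
        (by rw [Herm.norm_eq_one_of_affineMetric hs, one_pow])) hij
      rw [hκ]
      linarith
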